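/- Let $H$ be a complex separable infinite-dimensional Hilbert space with a fixed orthonormal basis $(e_n)_{n\ge 1}$. Let $c_0^*$ be the set of nonnegative nonincreasing sequences converging to $0$; for a nonnegative sequence $\rho$ converging to $0$ let $\rho^*\in c_0^*$ be its nonincreasing rearrangement, and for $\xi\in c_0^*$ put $(\xi_a)_n=\frac1n\sum_{j=1}^n\xi_j$. For a compact operator $X$ let $s(X)\in c_0^*$ be its sequence of $s$-numbers, i.e. the eigenvalues of $(X^*X)^{1/2}$ in nonincreasing order, repeated according to multiplicity (completed by zeros if $X$ has finite rank). Let $\mathscr L_1$ be the trace class, i.e. the compact operators with summable $s$-numbers. For a proper two-sided ideal $I\subsetneq B(H)$ let $\Sigma(I)=\{s(X): X\in I\}$; proper ideals consist of compact operators and correspond bijectively to their characteristic sets $\Sigma(I)$, the inverse map sending a characteristic set $\Sigma$ to the ideal generated by $\{\operatorname{diag}\xi:\xi\in\Sigma\}$. Let $I_a$ and ${}_aI$ be the ideals with characteristic sets $\Sigma(I_a)=\{\xi\in c_0^*: \xi=O(\eta_a)\text{ for some }\eta\in\Sigma(I)\}$ and $\Sigma({}_aI)=\{\xi\in c_0^*:\xi_a\in\Sigma(I)\}$.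 The am-closure of $I$ is $I^-={}_a(I_a)$, and $I$ is am-closed if $I=I^-$. An infinite matrix $P=(P_{ij})_{i,j\ge1}$ with nonnegative entries is substochastic if its row and column sums are at most $1$; row-stochastic (resp. column-stochastic) if it is substochastic and all row (resp. column) sums are $1$; doubly stochastic if it is both; block stochastic if it is a direct sum of finite doubly stochastic matrices (along consecutive blocks of indices). A matrix $Q$ is isometry stochastic (resp. co-isometry stochastic, unistochastic, orthostochastic) if $Q_{ij}=|L_{ij}|^2$ for the matrix $(L_{ij})$ of an isometry (resp. a co-isometry, a unitary, a unitary with real matrix entries) $L\in B(H)$; it is block orthostochastic if $Q_{ij}=L_{ij}^2$ for a direct sum $L$ of finite orthogonal matrices. The ideal $I$ is invariant under a class $\mathscr P$ of substochastic matrices if $(P\xi)^*\in\Sigma(I)$ for all $P\in\mathscr P$ and $\xi\in\Sigma(I)$. **Corollary 8.7.** Let $I\subsetneq B(H)$ be a proper two-sided ideal. The following conditions are equivalent. (i) $I$ is am-closed. (ii) $I$ is invariant under substochastic matrices. (ii$'$) $I$ is invariant under any single one of the following classes (each class giving an equivalent condition): row-stochastic, column-stochastic, doubly stochastic, isometry stochastic,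 co-isometry stochastic, unistochastic, orthostochastic matrices. If $I\neq\{0\}$, these conditions are also equivalent to each of the following. (iii) $I\supseteq\mathscr L_1$ and $I$ is invariant under block stochastic matrices. (iii$'$) $I\supseteq\mathscr L_1$ and $I$ is invariant under block orthostochastic matrices. -/

import Mathlib

open Filter Topology

noncomputable section

namespace AMIdeal

/-! Sequences and matrices are indexed by `ℕ`, starting at `0`. -/

/-- The cone of nonnegative nonincreasing real sequences converging to `0`. -/
def c0Star : Set (ℕ → ℝ) :=
  {ξ | (∀ n, 0 ≤ ξ n) ∧ Antitone ξ ∧ Tendsto ξ atTop (𝓝 0)}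

/-- The nonincreasing rearrangement `ρ*` of a nonnegative sequence `ρ` converging to `0`:
its `n`-th entry (counting from `0`) is the least `t ≥ 0` such that at most `n` entries of `ρ`
exceed `t`. -/
def rearrangement (ρ : ℕ → ℝ) (n : ℕ) : ℝ :=
  sInf {t : ℝ | 0 ≤ t ∧ {k | t < ρ k}.encard ≤ n}

/-- The sequence of arithmetic means `ξ_a`. -/
def arithMean (ξ : ℕ → ℝ) (n : ℕ) : ℝ :=
  (∑ j ∈ Finset.range (n + 1), ξ j) / ((n : ℝ) + 1)

/-! ### Infinite matrices -/

/-- The action of a matrix on a (bounded) sequence. -/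
def act (P : Matrix ℕ ℕ ℝ) (ξ : ℕ → ℝ) (i : ℕ) : ℝ :=
  ∑' j, P i j * ξ j

/-- Matrices with nonnegative entries whose row and column sums are at most `1`. -/
def substochastic : Set (Matrix ℕ ℕ ℝ) :=
  {P | (∀ i j, 0 ≤ P i j) ∧
    (∀ i, Summable (fun j => P i j) ∧ ∑' j, P i j ≤ 1) ∧
    (∀ j, Summable (fun i => P i j) ∧ ∑' i, P i j ≤ 1)}

/-- Substochastic matrices with all row sums equal to `1`. -/
def rowStochastic : Set (Matrix ℕ ℕ ℝ) :=
  {P | P ∈ substochastic ∧ ∀ i, HasSum (fun j => P i j) 1}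

/-- Substochastic matrices with all column sums equal to `1`. -/
def columnStochastic : Set (Matrix ℕ ℕ ℝ) :=
  {P | P ∈ substochastic ∧ ∀ j, HasSum (fun i => P i j) 1}

/-- Infinite doubly stochastic matrices. -/
def doublyStochasticInf : Set (Matrix ℕ ℕ ℝ) :=
  rowStochastic ∩ columnStochastic

/-- `M` is an infinite direct sum of finite (nonempty) square matrices, the block of size `d`
being taken from the class `C d`. The `k`-th block occupies the indices `n k ≤ i, j < n (k+1)`. -/
def IsDirectSum {R : Type*} [Zero R] (C : (d : ℕ) → Set (Matrix (Fin d) (Fin d) R))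
    (M : Matrix ℕ ℕ R) : Prop :=
  ∃ n : ℕ → ℕ, n 0 = 0 ∧ StrictMono n ∧
    (∀ i j, (¬ ∃ k, (n k ≤ i ∧ i < n (k + 1)) ∧ (n k ≤ j ∧ j < n (k + 1))) → M i j = 0) ∧
    ∀ k, (Matrix.of fun a b : Fin (n (k + 1) - n k) => M (n k + a) (n k + b)) ∈
      C (n (k + 1) - n k)

/-- Direct sums of finite doubly stochastic matrices. -/
def blockStochastic : Set (Matrix ℕ ℕ ℝ) :=
  {P | IsDirectSum (fun d => (doublyStochastic ℝ (Fin d) : Set (Matrix (Fin d) (Fin d) ℝ))) P}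

/-- Entrywise squares of direct sums of finite (real) orthogonal matrices. -/
def blockOrthostochastic : Set (Matrix ℕ ℕ ℝ) :=
  {Q | ∃ L : Matrix ℕ ℕ ℝ,
    IsDirectSum
      (fun d => (Matrix.orthogonalGroup (Fin d) ℝ : Set (Matrix (Fin d) (Fin d) ℝ))) L ∧
    ∀ i j, Q i j = L i j ^ 2}

section Operators

variable {H : Type*} [NormedAddCommGroup H] [InnerProductSpace ℂ H] [CompleteSpace H]

/-- The matrix entry `L_{ij} = (L e_j, e_i)` of an operator in the fixed orthonormal basis. -/
def entry (e : HilbertBasis ℕ ℂ H) (L : H →L[ℂ] H) (i j : ℕ) : ℂ :=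
  inner ℂ (e i) (L (e j))

/-- Schur-squares `|L_{ij}|²` of isometries `L`. -/
def isometryStochastic (e : HilbertBasis ℕ ℂ H) : Set (Matrix ℕ ℕ ℝ) :=
  {Q | ∃ L : H →L[ℂ] H, star L * L = 1 ∧ ∀ i j, Q i j = ‖entry e L i j‖ ^ 2}

/-- Schur-squares of co-isometries. -/
def coisometryStochastic (e : HilbertBasis ℕ ℂ H) : Set (Matrix ℕ ℕ ℝ) :=
  {Q | ∃ L : H →L[ℂ] H, L * star L = 1 ∧ ∀ i j, Q i j = ‖entry e L i j‖ ^ 2}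

/-- Schur-squares of unitaries. -/
def unistochastic (e : HilbertBasis ℕ ℂ H) : Set (Matrix ℕ ℕ ℝ) :=
  {Q | ∃ U ∈ unitary (H →L[ℂ] H), ∀ i j, Q i j = ‖entry e U i j‖ ^ 2}

/-- Schur-squares of orthogonal matrices, that is, of unitaries with real entries. -/
def orthostochastic (e : HilbertBasis ℕ ℂ H) : Set (Matrix ℕ ℕ ℝ) :=
  {Q | ∃ U ∈ unitary (H →L[ℂ] H), (∀ i j, (entry e U i j).im = 0) ∧
    ∀ i j, Q i j = ‖entry e U i j‖ ^ 2}

/-- `ξ = s(A)`: the operator `A` is compact and `ξ` lists the eigenvalues of `|A| = (A*A)^{1/2}`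
in nonincreasing order with repetition according to multiplicity, completed by zeros if `A` has
finite rank. (If `A` has infinite rank, only positive eigenvalues are listed; this is forced by
monotonicity, since then infinitely many entries are positive.) -/
def IsSNumbers (A : H →L[ℂ] H) (ξ : ℕ → ℝ) : Prop :=
  IsCompactOperator A ∧ ξ ∈ c0Star ∧
    ∀ t : ℝ, 0 < t → {n | ξ n = t}.encard =
      Cardinal.toENat (Module.rank ℂ
        (Module.End.eigenspace (CFC.abs A : H →L[ℂ] H).toLinearMap (t : ℂ)))

/-- The trace class: compact operators with summable s-numbers. -/
def traceClass (H : Type*) [NormedAddCommGroup H] [InnerProductSpace ℂ H] [CompleteSpace H] :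
    Set (H →L[ℂ] H) :=
  {A | ∃ ξ, IsSNumbers A ξ ∧ Summable ξ}

/-- The characteristic set `Σ(I) = {s(X) | X ∈ I}` of a two-sided ideal of `B(H)`. -/
def charSet (I : TwoSidedIdeal (H →L[ℂ] H)) : Set (ℕ → ℝ) :=
  {ξ | ∃ X ∈ I, IsSNumbers X ξ}

/-- `D = diag ξ` with respect to the fixed orthonormal basis. -/
def IsDiag (e : HilbertBasis ℕ ℂ H) (ξ : ℕ → ℝ) (D : H →L[ℂ] H) : Prop :=
  ∀ n, D (e n) = (ξ n : ℂ) • e n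

/-- The ideal associated with a characteristic set `S`: the two-sided ideal generated by the
operators `diag ξ`, `ξ ∈ S`. -/
def idealOf (e : HilbertBasis ℕ ℂ H) (S : Set (ℕ → ℝ)) : TwoSidedIdeal (H →L[ℂ] H) :=
  TwoSidedIdeal.span {D | ∃ ξ ∈ S, IsDiag e ξ D}

/-- The pre-arithmetic mean ideal `_aI`. -/
def preArithMeanIdeal (e : HilbertBasis ℕ ℂ H) (I : TwoSidedIdeal (H →L[ℂ] H)) :
    TwoSidedIdeal (H →L[ℂ] H) :=
  idealOf e {ξ | ξ ∈ c0Star ∧ arithMean ξ ∈ charSet I}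

/-- The arithmetic mean ideal `I_a`. -/
def arithMeanIdeal (e : HilbertBasis ℕ ℂ H) (I : TwoSidedIdeal (H →L[ℂ] H)) :
    TwoSidedIdeal (H →L[ℂ] H) :=
  idealOf e {ξ | ξ ∈ c0Star ∧ ∃ η ∈ charSet I, ∃ M : ℝ, 0 < M ∧ ∀ n, ξ n ≤ M * arithMean η n}

/-- The am-closure `I⁻ = _a(I_a)`. -/
def amClosure (e : HilbertBasis ℕ ℂ H) (I : TwoSidedIdeal (H →L[ℂ] H)) :
    TwoSidedIdeal (H →L[ℂ] H) :=
  preArithMeanIdeal e (arithMeanIdeal e I)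

/-- `I` is am-closed if it equals its am-closure. -/
def IsAmClosed (e : HilbertBasis ℕ ℂ H) (I : TwoSidedIdeal (H →L[ℂ] H)) : Prop :=
  I = amClosure e I

/-- `I` is invariant under the class `Ps` of matrices: `(Pξ)* ∈ Σ(I)` for all `P ∈ Ps` and
`ξ ∈ Σ(I)`. -/
def InvariantUnder (I : TwoSidedIdeal (H →L[ℂ] H)) (Ps : Set (Matrix ℕ ℕ ℝ)) : Prop :=
  ∀ P ∈ Ps, ∀ ξ ∈ charSet I, rearrangement (act P ξ) ∈ charSet I

end Operators

end AMIdeal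

end

set_option linter.unusedSectionVars false

noncomputable section

namespace AMIdeal

/-! ### Diagonal and finite-rank operators with respect to a Hilbert basis. -/

section Operators

variable {H : Type*} [NormedAddCommGroup H] [InnerProductSpace ℂ H] [CompleteSpace H]

/-! Operators are first traded for sequences. By the singular value decomposition, a compact `X`
lies in `I` exactly when `diag s(X)` does, and membership of a nonnegative null diagonal depends
only on its rearrangement (`IsSNumbers.mem_iff`, `rearrangement_mem_charSet_iff`). A proper ideal
contains only compact operators (`eq_top_of_not_isCompactOperator`), so it is determined by its
characteristic set. Approximation numbers show that `idealOf` adds nothing to a characteristic set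
(`charSet_idealOf`). Hence `I` is am-closed iff `charSet I` is hereditary under submajorization,
i.e. comparison of partial sums (`isAmClosed_iff`).

Substochastic matrices do not increase sums of largest entries (`arithMean_rearrangement_act_le`),
so am-closed ideals are invariant under all of them, and inclusions of classes pass this down to the
orthostochastic and block classes.

For the way back, let `ξ` be submajorized by `η` in `charSet I`. If `ξ` is summable, it suffices
that `I` contains the trace class. This is assumed in the block conditions; for a nonzero
orthostochastically invariant `I` it holds because a Householder reflection spreads a rank-one
projection over any normalized summable sequence (`traceClass_subset`). If `ξ` is not summable, the
partial sums of `η` exceed those of `ξ / 2` by a gap tending to infinity. Cutting at indices where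
the gap is minimal over the remaining tail gives finite blocks on which `ξ / 2` is again
submajorized by `η`, and a weak Horn theorem on each block (`exists_orthogonal_ge`) yields a block
orthostochastic `Q` with `ξ / 2 ≤ Q η` (`exists_blockOrthostochastic_ge`). The zero ideal is treated
directly. -/

theorem clm_ext_basis (b : HilbertBasis ℕ ℂ H) {S T : H →L[ℂ] H}
    (h : ∀ n, S (b n) = T (b n)) : S = T := by
  refine ContinuousLinearMap.ext_on (s := Set.range b) ?_ ?_
  · have := b.dense_span
    rw [Submodule.dense_iff_topologicalClosure_eq_top]
    exact this
  · rintro _ ⟨n, rfl⟩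
    exact h n

theorem eq_of_inner_basis (b : HilbertBasis ℕ ℂ H) {x y : H}
    (h : ∀ n, inner ℂ (b n) x = inner ℂ (b n) y) : x = y := by
  apply b.repr.injective
  ext n
  simpa [b.repr_apply_apply] using h n

theorem inner_basis (b : HilbertBasis ℕ ℂ H) (i j : ℕ) :
    inner ℂ (b i) (b j) = if i = j then (1 : ℂ) else 0 :=
  orthonormal_iff_ite.mp b.orthonormal i j

theorem norm_basis (b : HilbertBasis ℕ ℂ H) (i : ℕ) : ‖b i‖ = 1 := b.orthonormal.1 i

/-- A bounded orthogonal sequence is the image of a Hilbert basis under a bounded operator. -/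
theorem exists_clm_basis (b : HilbertBasis ℕ ℂ H) (w : ℕ → H)
    (hw : ∀ i j, i ≠ j → inner ℂ (w i) (w j) = 0) (M : ℝ) (hM : ∀ n, ‖w n‖ ≤ M) :
    ∃ T : H →L[ℂ] H, ‖T‖ ≤ M ∧ ∀ n, T (b n) = w n := by
  have hM0 : 0 ≤ M := (norm_nonneg _).trans (hM 0)
  -- Lines instead of normalized vectors: some `w i` may vanish. Bessel's inequality then gives both
  -- convergence and the norm bound.
  have hV : OrthogonalFamily ℂ (fun i => (Submodule.span ℂ {w i} : Submodule ℂ H))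
      fun i => (Submodule.span ℂ {w i} : Submodule ℂ H).subtypeₗᵢ := by
    intro i j hij x y
    obtain ⟨c, hc⟩ := Submodule.mem_span_singleton.mp x.2
    obtain ⟨d, hd⟩ := Submodule.mem_span_singleton.mp y.2
    change inner ℂ (x : H) (y : H) = 0
    rw [← hc, ← hd, inner_smul_left, inner_smul_right, hw i j hij, mul_zero, mul_zero]
  let f : H → ∀ i, (Submodule.span ℂ {w i} : Submodule ℂ H) := fun x i =>
    ⟨inner ℂ (b i) x • w i, Submodule.smul_mem _ _ (Submodule.mem_span_singleton_self _)⟩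
  have hb : ∀ x (s : Finset ℕ), ∑ i ∈ s, ‖f x i‖ ^ 2 ≤ M ^ 2 * ‖x‖ ^ 2 := by
    intro x s
    calc ∑ i ∈ s, ‖f x i‖ ^ 2 ≤ ∑ i ∈ s, M ^ 2 * ‖inner ℂ (b i) x‖ ^ 2 := by
          refine Finset.sum_le_sum fun i _ => ?_
          have : ‖f x i‖ = ‖inner ℂ (b i) x‖ * ‖w i‖ := norm_smul _ _
          rw [this, mul_pow, mul_comm]
          have := hM i
          gcongr
      _ ≤ _ := by
          rw [← Finset.mul_sum]
          gcongr
          exact b.orthonormal.sum_inner_products_le x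
  have hs : ∀ x, Summable fun i => inner ℂ (b i) x • w i := fun x =>
    (hV.summable_iff_norm_sq_summable (f x)).mpr
      (summable_of_sum_le (fun _ => sq_nonneg _) (hb x))
  let L : H →ₗ[ℂ] H :=
    { toFun := fun x => ∑' i, inner ℂ (b i) x • w i
      map_add' := fun x y => by
        rw [← (hs x).tsum_add (hs y)]
        simp only [inner_add_right, add_smul]
      map_smul' := fun c x => by
        simp only [inner_smul_right, mul_smul, RingHom.id_apply]
        exact (hs x).tsum_const_smul c }
  refine ⟨L.mkContinuous M fun x => ?_, L.mkContinuous_norm_le hM0 _, fun n => ?_⟩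
  · refine le_of_tendsto (hs x).hasSum.norm (Eventually.of_forall fun s => ?_)
    refine le_of_sq_le_sq ?_ (by positivity)
    rw [mul_pow]
    refine le_trans (le_of_eq ?_) (hb x s)
    exact hV.norm_sum (f x) s
  · change ∑' i, inner ℂ (b i) (b n) • w i = w n
    rw [tsum_eq_single n]
    · simp [norm_basis]
    · intro m hm
      simp [inner_basis, hm]

theorem exists_isDiag (b : HilbertBasis ℕ ℂ H) (ρ : ℕ → ℝ) (M : ℝ) (hM : ∀ n, |ρ n| ≤ M) :
    ∃ D : H →L[ℂ] H, ‖D‖ ≤ M ∧ IsDiag b ρ D := by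
  refine exists_clm_basis b (fun n => (ρ n : ℂ) • b n) ?_ M ?_
  · intro i j hij
    simp [inner_basis, hij]
  · intro n
    simpa [norm_smul, norm_basis] using hM n

theorem IsDiag.unique {b : HilbertBasis ℕ ℂ H} {ρ : ℕ → ℝ} {D E : H →L[ℂ] H}
    (hD : IsDiag b ρ D) (hE : IsDiag b ρ E) : D = E :=
  clm_ext_basis b fun n => by rw [hD n, hE n]

theorem IsDiag.mul {b : HilbertBasis ℕ ℂ H} {ρ σ : ℕ → ℝ} {D E : H →L[ℂ] H}
    (hD : IsDiag b ρ D) (hE : IsDiag b σ E) : IsDiag b (fun n => ρ n * σ n) (D * E) := by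
  intro n
  rw [mul_apply_eq_comp, hE n, map_smul, hD n, smul_smul]
  push_cast
  rw [mul_comm]

theorem IsDiag.add {b : HilbertBasis ℕ ℂ H} {ρ σ : ℕ → ℝ} {D E : H →L[ℂ] H}
    (hD : IsDiag b ρ D) (hE : IsDiag b σ E) : IsDiag b (fun n => ρ n + σ n) (D + E) := by
  intro n
  rw [add_apply, hE n, hD n, ← add_smul]
  push_cast
  rfl

theorem IsDiag.star_eq {b : HilbertBasis ℕ ℂ H} {ρ : ℕ → ℝ} {D : H →L[ℂ] H}
    (hD : IsDiag b ρ D) : star D = D := by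
  refine clm_ext_basis b fun n => eq_of_inner_basis b fun m => ?_
  rw [ContinuousLinearMap.star_eq_adjoint, ContinuousLinearMap.adjoint_inner_right, hD n, hD m,
    inner_smul_left, inner_smul_right, inner_basis]
  by_cases h : m = n <;> simp [h]

theorem IsDiag.inner_apply {b : HilbertBasis ℕ ℂ H} {ρ : ℕ → ℝ} {D : H →L[ℂ] H}
    (hD : IsDiag b ρ D) (n : ℕ) (x : H) : inner ℂ (b n) (D x) = ρ n * inner ℂ (b n) x := by
  have h := ContinuousLinearMap.adjoint_inner_right D (b n) x
  rw [← ContinuousLinearMap.star_eq_adjoint, hD.star_eq, hD n, inner_smul_left] at h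
  simpa using h

/-- Factor `D = E* E` with `E = diag √ρ`. -/
theorem IsDiag.nonneg {b : HilbertBasis ℕ ℂ H} {ρ : ℕ → ℝ} {D : H →L[ℂ] H}
    (hD : IsDiag b ρ D) (hρ : ∀ n, 0 ≤ ρ n) : 0 ≤ D := by
  have hb : ∀ n, |√(ρ n)| ≤ √‖D‖ := fun n => by
    rw [abs_of_nonneg (Real.sqrt_nonneg _)]
    refine Real.sqrt_le_sqrt ?_
    have := D.le_opNorm (b n)
    rwa [hD n, norm_smul, norm_basis, mul_one, mul_one, Complex.norm_real, Real.norm_eq_abs,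
      abs_of_nonneg (hρ n)] at this
  obtain ⟨E, -, hE⟩ := exists_isDiag b (fun n => √(ρ n)) _ hb
  have h : D = star E * E := by
    rw [hE.star_eq]
    refine hD.unique ?_
    have := hE.mul hE
    simpa only [Real.mul_self_sqrt (hρ _)] using this
  rw [h]
  exact star_mul_self_nonneg E

theorem IsDiag.norm_le {b : HilbertBasis ℕ ℂ H} {ρ : ℕ → ℝ} {D : H →L[ℂ] H}
    (hD : IsDiag b ρ D) {M : ℝ} (hM : ∀ n, |ρ n| ≤ M) : ‖D‖ ≤ M := by
  obtain ⟨E, hE, hE'⟩ := exists_isDiag b ρ M hM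
  rwa [hD.unique hE']

theorem isCompactOperator_of_finiteDimensional_range (T : H →L[ℂ] H)
    (h : FiniteDimensional ℂ (LinearMap.range T.toLinearMap)) : IsCompactOperator T := by
  have := FiniteDimensional.proper_rclike ℂ (LinearMap.range T.toLinearMap)
  have h1 := isCompactOperator_of_locallyCompactSpace_dom
    (T.codRestrict (LinearMap.range T.toLinearMap) fun x => ⟨x, rfl⟩)
  exact h1.clm_comp (LinearMap.range T.toLinearMap).subtypeL

/-- The rank of the diagonal truncation is at most `n`, and the tail has small norm. -/
theorem IsDiag.exists_rank_le {b : HilbertBasis ℕ ℂ H} {ρ : ℕ → ℝ} {D : H →L[ℂ] H}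
    (hD : IsDiag b ρ D) (n : ℕ) {M : ℝ} (hM0 : 0 ≤ M) (hM : ∀ k, n ≤ k → |ρ k| ≤ M) :
    ∃ F : H →L[ℂ] H, F.toLinearMap.rank ≤ n ∧ ‖D - F‖ ≤ M := by
  let F : H →L[ℂ] H := ∑ k ∈ Finset.range n, (innerSL ℂ (b k)).smulRight ((ρ k : ℂ) • b k)
  have hF : ∀ x, F x = ∑ k ∈ Finset.range n, inner ℂ (b k) x • (ρ k : ℂ) • b k := fun x => by
    simp [F]
  refine ⟨F, ?_, ?_⟩
  · classical
    have hr : LinearMap.range F.toLinearMap ≤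
        Submodule.span ℂ ((Finset.range n).image b : Finset H) := by
      rintro _ ⟨x, rfl⟩
      change F x ∈ _
      rw [hF]
      refine Submodule.sum_mem _ fun k hk => Submodule.smul_mem _ _ (Submodule.smul_mem _ _ ?_)
      exact Submodule.subset_span (by simpa using ⟨k, by simpa using hk, rfl⟩)
    refine (Submodule.rank_mono hr).trans ((rank_span_finset_le _).trans ?_)
    exact_mod_cast Finset.card_image_le.trans (Finset.card_range n).le
  · have : IsDiag b (fun k => if k < n then 0 else ρ k) (D - F) := by
      intro k
      rw [sub_apply, hD k, hF]
      by_cases hk : k < n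
      · rw [Finset.sum_eq_single k]
        · simp [norm_basis, hk]
        · intro j _ hj
          simp [inner_basis, hj]
        · intro h
          simp [hk] at h
      · rw [Finset.sum_eq_zero]
        · simp [hk]
        · intro j hj
          have : j ≠ k := by rintro rfl; simp at hj; omega
          simp [inner_basis, this]
    refine this.norm_le fun k => ?_
    split_ifs with hk
    · simpa
    · exact hM k (not_lt.mp hk)

/-- Operators approximable in norm by finite rank operators are compact. -/
theorem isCompactOperator_of_approx {T : H →L[ℂ] H} {ξ : ℕ → ℝ} (hξ : Tendsto ξ atTop (𝓝 0))
    (h : ∀ n : ℕ, ∃ F : H →L[ℂ] H, F.toLinearMap.rank ≤ n ∧ ‖T - F‖ ≤ ξ n) :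
    IsCompactOperator T := by
  choose F hF hT using h
  refine isCompactOperator_of_tendsto (l := atTop) (F := F) (f := T) ?_ (Eventually.of_forall fun n => ?_)
  · rw [tendsto_iff_norm_sub_tendsto_zero]
    refine squeeze_zero (fun _ => norm_nonneg _) (fun n => ?_) hξ
    rw [norm_sub_rev]
    exact hT n
  · refine isCompactOperator_of_finiteDimensional_range _ ?_
    rw [FiniteDimensional, ← Module.rank_lt_aleph0_iff]
    exact (hF n).trans_lt (Cardinal.natCast_lt_aleph0)

theorem exists_forall_ge_abs_le {ρ : ℕ → ℝ} (hρ : Tendsto ρ atTop (𝓝 0)) :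
    ∃ s : ℕ → ℝ, (∀ n k, n ≤ k → |ρ k| ≤ s n) ∧ (∀ n, 0 ≤ s n) ∧ Tendsto s atTop (𝓝 0) := by
  obtain ⟨M, hM⟩ := hρ.abs.bddAbove_range
  have hb : ∀ n, BddAbove (Set.range fun k => |ρ (n + k)|) := fun n =>
    ⟨M, by rintro _ ⟨k, rfl⟩; exact hM ⟨n + k, rfl⟩⟩
  have h0 : ∀ n, 0 ≤ ⨆ k, |ρ (n + k)| := fun n => Real.iSup_nonneg fun k => abs_nonneg _
  refine ⟨fun n => ⨆ k, |ρ (n + k)|, fun n k hk => ?_, h0, ?_⟩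
  · obtain ⟨j, rfl⟩ := Nat.exists_eq_add_of_le hk
    exact le_ciSup (hb n) j
  · rw [Metric.tendsto_atTop] at hρ ⊢
    intro ε hε
    obtain ⟨N, hN⟩ := hρ (ε / 2) (half_pos hε)
    refine ⟨N, fun n hn => ?_⟩
    rw [Real.dist_eq, sub_zero, abs_of_nonneg (h0 n)]
    refine lt_of_le_of_lt (ciSup_le fun k => ?_) (half_lt_self hε)
    have := hN (n + k) (by omega)
    rw [Real.dist_eq, sub_zero] at this
    exact this.le

theorem IsDiag.isCompactOperator {b : HilbertBasis ℕ ℂ H} {ρ : ℕ → ℝ} {D : H →L[ℂ] H}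
    (hD : IsDiag b ρ D) (hρ : Tendsto ρ atTop (𝓝 0)) : IsCompactOperator D := by
  obtain ⟨s, hs, hs0, hst⟩ := exists_forall_ge_abs_le hρ
  exact isCompactOperator_of_approx hst fun n => hD.exists_rank_le n (hs0 n) (hs n)

end Operators

/-! ### Decreasing rearrangements -/

theorem finite_lt_of_tendsto_zero {ρ : ℕ → ℝ} (hρ : Tendsto ρ atTop (𝓝 0)) {t : ℝ} (ht : 0 < t) :
    {k | t < ρ k}.Finite := by
  have h := hρ.eventually (gt_mem_nhds ht)
  rw [← Nat.cofinite_eq_atTop, eventually_cofinite] at h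
  exact h.subset fun k hk => not_lt.mpr (le_of_lt hk)

/-- The infimum in the definition is attained, so `ρ*` can be handled entirely by counting entries
above a level. -/
theorem rearrangement_le_iff {ρ : ℕ → ℝ} (hρ : Tendsto ρ atTop (𝓝 0)) {t : ℝ} (ht : 0 ≤ t)
    (n : ℕ) : rearrangement ρ n ≤ t ↔ {k | t < ρ k}.encard ≤ n := by
  constructor
  · intro h
    by_contra hlt
    rw [not_le] at hlt
    -- The least of `n + 1` entries exceeding `t` is a lower bound for every admissible level, hence
    -- for the infimum.
    obtain ⟨F, hF, hFc⟩ := Set.exists_subset_encard_eq (Order.add_one_le_of_lt hlt)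
    have hFf : F.Finite := Set.finite_of_encard_eq_coe (k := n + 1) (by exact_mod_cast hFc)
    have hFn : F.Nonempty := by
      rw [Set.nonempty_iff_ne_empty]
      rintro rfl
      rw [Set.encard_empty] at hFc
      exact absurd hFc.symm (by exact_mod_cast Nat.succ_ne_zero n)
    obtain ⟨a, haF, ha⟩ := Set.exists_min_image F ρ hFf hFn
    have hM : (upperBounds (Set.range ρ)).Nonempty := hρ.bddAbove_range
    obtain ⟨M, hM⟩ := hM
    have : ρ a ≤ rearrangement ρ n := by
      refine le_csInf ⟨max M 0, le_max_right _ _, ?_⟩ ?_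
      · have : {k | max M 0 < ρ k} = ∅ := by
          ext k
          simp only [Set.mem_ofPred_eq, Set.mem_empty_iff_false, iff_false, not_lt]
          exact (hM ⟨k, rfl⟩).trans (le_max_left _ _)
        rw [this, Set.encard_empty]
        exact zero_le
      · rintro s ⟨-, hs⟩
        by_contra! hsa
        have h1 : F.encard ≤ {k | s < ρ k}.encard :=
          Set.encard_le_encard fun k hk => hsa.trans_le (ha k hk)
        rw [hFc] at h1
        have h2 := h1.trans hs
        exact absurd h2 (not_le.mpr (by exact_mod_cast Nat.lt_succ_self n))
    exact absurd (this.trans h) (not_le.mpr (hF haF))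
  · intro h
    exact csInf_le ⟨0, fun s hs => hs.1⟩ ⟨ht, h⟩

theorem rearrangement_nonneg (ρ : ℕ → ℝ) (n : ℕ) : 0 ≤ rearrangement ρ n :=
  Real.sInf_nonneg fun _ h => h.1

theorem rearrangement_mem_c0Star {ρ : ℕ → ℝ} (hρ : Tendsto ρ atTop (𝓝 0)) :
    rearrangement ρ ∈ c0Star := by
  refine ⟨rearrangement_nonneg ρ, fun m n hmn => ?_, ?_⟩
  · rw [rearrangement_le_iff hρ (rearrangement_nonneg ρ m)]
    exact ((rearrangement_le_iff hρ (rearrangement_nonneg ρ m) m).mp le_rfl).trans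
      (by exact_mod_cast hmn)
  · rw [Metric.tendsto_atTop]
    intro ε hε
    have hf := finite_lt_of_tendsto_zero hρ (half_pos hε)
    refine ⟨hf.toFinset.card, fun n hn => ?_⟩
    rw [Real.dist_eq, sub_zero, abs_of_nonneg (rearrangement_nonneg _ _)]
    refine lt_of_le_of_lt ?_ (half_lt_self hε)
    rw [rearrangement_le_iff hρ (half_pos hε).le, hf.encard_eq_coe_toFinset_card]
    exact_mod_cast hn

theorem encard_lt_rearrangement {ρ : ℕ → ℝ} (hρ : Tendsto ρ atTop (𝓝 0)) {t : ℝ} (ht : 0 < t) :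
    {n | t < rearrangement ρ n}.encard = {k | t < ρ k}.encard := by
  have hf := finite_lt_of_tendsto_zero hρ ht
  have : {n | t < rearrangement ρ n} = ((Finset.range hf.toFinset.card : Finset ℕ) : Set ℕ) := by
    ext n
    rw [Set.mem_ofPred_eq, ← not_le, rearrangement_le_iff hρ ht.le, hf.encard_eq_coe_toFinset_card]
    simp
  rw [this, hf.encard_eq_coe_toFinset_card, Set.encard_coe_eq_coe_finsetCard, Finset.card_range]

/-- Only finitely many entries exceed `t / 2`, so none lies just below `t`. This turns counts above
a level into multiplicities of single values. -/
theorem eventually_setOf_lt_eq {ρ : ℕ → ℝ} (hρ : Tendsto ρ atTop (𝓝 0)) {t : ℝ} (ht : 0 < t) :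
    ∀ᶠ s in 𝓝[<] t, {k | s < ρ k} = {k | t ≤ ρ k} := by
  have hf := finite_lt_of_tendsto_zero hρ (half_pos ht)
  have h1 : ∀ᶠ s in 𝓝[<] t, ∀ k ∈ {k | t / 2 < ρ k}, ρ k < t → ρ k < s := by
    rw [eventually_all_finite hf]
    intro k _
    by_cases hk : ρ k < t
    · filter_upwards [nhdsWithin_le_nhds (lt_mem_nhds hk)] with s hs _ using hs
    · exact Eventually.of_forall fun s h => absurd h hk
  filter_upwards [h1, nhdsWithin_le_nhds (lt_mem_nhds (half_lt_self ht)), self_mem_nhdsWithin]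
    with s hs hs2 hst
  ext k
  simp only [Set.mem_ofPred_eq]
  constructor
  · intro h
    by_contra! hk
    exact absurd (hs k (hs2.trans h) hk) (not_lt.mpr h.le)
  · intro h
    exact lt_of_lt_of_le hst h

theorem encard_eq_rearrangement {ρ : ℕ → ℝ} (hρ : Tendsto ρ atTop (𝓝 0)) {t : ℝ} (ht : 0 < t) :
    {n | rearrangement ρ n = t}.encard = {k | ρ k = t}.encard := by
  have hρ' := (rearrangement_mem_c0Star hρ).2.2
  have hpos : ∀ᶠ s in 𝓝[<] t, 0 < s := nhdsWithin_le_nhds (lt_mem_nhds ht)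
  obtain ⟨s, h1, h2, h3⟩ :=
    ((eventually_setOf_lt_eq hρ ht).and ((eventually_setOf_lt_eq hρ' ht).and hpos)).exists
  have hdecomp : ∀ σ : ℕ → ℝ, {k | t ≤ σ k}.encard = {k | σ k = t}.encard + {k | t < σ k}.encard := by
    intro σ
    rw [← Set.encard_union_eq]
    · congr 1
      ext k
      simp [le_iff_eq_or_lt, eq_comm]
    · rw [Set.disjoint_left]
      intro k hk hk'
      exact absurd hk (ne_of_gt hk')
  have h4 := encard_lt_rearrangement hρ h3
  rw [h1, h2, hdecomp, hdecomp, encard_lt_rearrangement hρ ht] at h4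
  have hf := finite_lt_of_tendsto_zero hρ ht
  -- Cancelling the count of entries above `t` is legitimate because it is finite.
  exact (ENat.add_left_injective_of_ne_top hf.encard_lt_top.ne) h4

/-- Comparison of multiplicities of the positive values yields a partial injection matching
values. -/
theorem exists_injOn_of_encard_le {ξ ρ : ℕ → ℝ} (hξ : Tendsto ξ atTop (𝓝 0))
    (h : ∀ t : ℝ, 0 < t → {n | ξ n = t}.encard ≤ {n | ρ n = t}.encard) :
    ∃ f : ℕ → ℕ, Set.InjOn f {n | 0 < ξ n} ∧ ∀ n, 0 < ξ n → ρ (f n) = ξ n := by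
  have key : ∀ t : ℝ, ∃ g : ℕ → ℕ, 0 < t → {n | ξ n = t} ⊆ g ⁻¹' {n | ρ n = t} ∧
      Set.InjOn g {n | ξ n = t} := by
    intro t
    by_cases ht : 0 < t
    · have hf : {n | ξ n = t}.Finite :=
        (finite_lt_of_tendsto_zero hξ (half_pos ht)).subset fun n hn => by
          rw [Set.mem_ofPred_eq] at hn ⊢
          rw [hn]
          exact half_lt_self ht
      obtain ⟨g, hg⟩ := hf.exists_injOn_of_encard_le (h t ht)
      exact ⟨g, fun _ => hg⟩
    · exact ⟨id, fun h => absurd h ht⟩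
  choose g hg using key
  refine ⟨fun n => g (ξ n) n, ?_, fun n hn => (hg _ hn).1 rfl⟩
  intro m hm n hn hmn
  have h1 : ρ (g (ξ m) m) = ξ m := (hg _ hm).1 rfl
  have h2 : ρ (g (ξ n) n) = ξ n := (hg _ hn).1 rfl
  have h3 : ξ m = ξ n := by
    rw [← h1, ← h2]
    exact congrArg ρ hmn
  refine (hg _ hm).2 rfl h3.symm ?_
  simpa [h3] using hmn

/-- Positive entries of `ρ*` are matched injectively with entries of `ρ`; vanishing ones are
dropped, which is why `F` may have fewer than `n` elements. -/
theorem exists_finset_sum_rearrangement_le {ρ : ℕ → ℝ} (hρ : Tendsto ρ atTop (𝓝 0))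
    (n : ℕ) : ∃ F : Finset ℕ, F.card ≤ n ∧
      ∑ j ∈ Finset.range n, rearrangement ρ j ≤ ∑ i ∈ F, ρ i := by
  obtain ⟨f, hf, hfρ⟩ := exists_injOn_of_encard_le (rearrangement_mem_c0Star hρ).2.2
    fun t ht => (encard_eq_rearrangement hρ ht).le
  refine ⟨((Finset.range n).filter fun j => 0 < rearrangement ρ j).image f, ?_, ?_⟩
  · exact Finset.card_image_le.trans ((Finset.card_filter_le _ _).trans (Finset.card_range n).le)
  · rw [Finset.sum_image]
    · rw [← Finset.sum_filter_add_sum_filter_not _ (fun j => 0 < rearrangement ρ j)]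
      have : ∑ x ∈ Finset.range n with ¬0 < rearrangement ρ x, rearrangement ρ x ≤ 0 :=
        Finset.sum_nonpos fun j hj => not_lt.mp (Finset.mem_filter.mp hj).2
      have h2 : ∑ x ∈ Finset.range n with 0 < rearrangement ρ x, rearrangement ρ x =
          ∑ x ∈ Finset.range n with 0 < rearrangement ρ x, ρ (f x) :=
        Finset.sum_congr rfl fun j hj => (hfρ j (Finset.mem_filter.mp hj).2).symm
      linarith
    · intro i hi j hj hij
      exact hf (Finset.mem_filter.mp hi).2 (Finset.mem_filter.mp hj).2 hij

/-! ### Arithmetic means -/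

theorem arithMean_nonneg {ξ : ℕ → ℝ} (h : ∀ n, 0 ≤ ξ n) (n : ℕ) : 0 ≤ arithMean ξ n :=
  div_nonneg (Finset.sum_nonneg fun i _ => h i) (by positivity)

theorem arithMean_mem_c0Star {ξ : ℕ → ℝ} (h : ξ ∈ c0Star) : arithMean ξ ∈ c0Star := by
  obtain ⟨h0, ha, ht⟩ := h
  refine ⟨arithMean_nonneg h0, antitone_nat_of_succ_le fun n => ?_, ?_⟩
  · unfold arithMean
    rw [div_le_div_iff₀ (by positivity) (by positivity), Finset.sum_range_succ _ (n + 1)]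
    have : (n + 1) • ξ (n + 1) ≤ ∑ j ∈ Finset.range (n + 1), ξ j := by
      have := Finset.card_nsmul_le_sum (Finset.range (n + 1)) ξ (ξ (n + 1)) fun j hj =>
        ha (by simp at hj; omega)
      simpa using this
    rw [nsmul_eq_mul] at this
    push_cast at this ⊢
    linarith
  · have := (ht.cesaro).comp (tendsto_add_atTop_nat 1)
    refine this.congr fun n => ?_
    simp [arithMean, div_eq_inv_mul]

/-! ### Substochastic matrices -/

theorem summable_mul_of_mem_c0Star {ξ : ℕ → ℝ} (hξ : ξ ∈ c0Star) {c : ℕ → ℝ} (hc0 : ∀ j, 0 ≤ c j)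
    (hc : Summable c) : Summable fun j => c j * ξ j :=
  Summable.of_nonneg_of_le (fun j => mul_nonneg (hc0 j) (hξ.1 j))
    (fun j => mul_le_mul_of_nonneg_left (hξ.2.1 (Nat.zero_le j)) (hc0 j)) (hc.mul_right (ξ 0))

/-- Weights at most `1` of total mass at most `m` do best on the first `m` indices. Termwise, `c j *
ξ j` is at most `c j * ξ m`, plus `ξ j - ξ m` when `j < m`. -/
theorem tsum_mul_le_sum_range {ξ : ℕ → ℝ} (hξ : ξ ∈ c0Star) {c : ℕ → ℝ} (hc0 : ∀ j, 0 ≤ c j)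
    (hc1 : ∀ j, c j ≤ 1) (hc : Summable c) {m : ℕ} (hm : ∑' j, c j ≤ m) :
    ∑' j, c j * ξ j ≤ ∑ j ∈ Finset.range m, ξ j := by
  have h1 : HasSum (fun j => if j ∈ Finset.range m then ξ j - ξ m else 0)
      (∑ j ∈ Finset.range m, (ξ j - ξ m)) := by
    have : HasSum (fun j => if j ∈ Finset.range m then ξ j - ξ m else 0) _ :=
      hasSum_sum_of_ne_finset_zero (s := Finset.range m) (fun j hj => if_neg hj)
    rwa [Finset.sum_congr rfl fun j hj => if_pos hj] at this
  have h2 := h1.add (hc.hasSum.mul_right (ξ m))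
  have h3 := (summable_mul_of_mem_c0Star hξ hc0 hc).hasSum
  have h4 := hasSum_le (fun j => ?_) h3 h2
  · refine h4.trans ?_
    rw [Finset.sum_sub_distrib]
    simp only [Finset.sum_const, Finset.card_range, nsmul_eq_mul]
    have := mul_le_mul_of_nonneg_right hm (hξ.1 m)
    linarith
  · simp only [Finset.mem_range]
    split_ifs with hj
    · have := hξ.2.1 hj.le
      nlinarith [hc1 j]
    · have := hξ.2.1 (not_lt.mp hj)
      have := mul_le_mul_of_nonneg_left this (hc0 j)
      linarith

theorem act_nonneg {P : Matrix ℕ ℕ ℝ} (hP : ∀ i j, 0 ≤ P i j) {ξ : ℕ → ℝ}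
    (hξ : ∀ n, 0 ≤ ξ n) (i : ℕ) : 0 ≤ act P ξ i :=
  tsum_nonneg fun j => mul_nonneg (hP i j) (hξ j)

/-- With weights `c j = ∑ i ∈ F, P i j`, the column sums give `c j ≤ 1` and the row sums bound the
total mass by `F.card`. -/
theorem sum_act_le {P : Matrix ℕ ℕ ℝ} (hP : P ∈ substochastic) {ξ : ℕ → ℝ} (hξ : ξ ∈ c0Star)
    (F : Finset ℕ) {m : ℕ} (hm : F.card ≤ m) :
    ∑ i ∈ F, act P ξ i ≤ ∑ j ∈ Finset.range m, ξ j := by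
  obtain ⟨h0, hr, hc⟩ := hP
  have hs : Summable fun j => ∑ i ∈ F, P i j := summable_sum fun i _ => (hr i).1
  calc ∑ i ∈ F, act P ξ i = ∑' j, (∑ i ∈ F, P i j) * ξ j := by
        simp only [act, Finset.sum_mul]
        exact (Summable.tsum_finsetSum fun i _ => summable_mul_of_mem_c0Star hξ (h0 i) (hr i).1).symm
    _ ≤ _ := by
        refine tsum_mul_le_sum_range hξ (fun j => Finset.sum_nonneg fun i _ => h0 i j)
          (fun j => ((hc j).1.sum_le_tsum _ fun i _ => h0 i j).trans (hc j).2) hs ?_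
        rw [Summable.tsum_finsetSum fun i _ => (hr i).1]
        refine (Finset.sum_le_sum fun i _ => (hr i).2).trans ?_
        simpa using hm

/-- Infinitely many entries `≥ ε` would keep all arithmetic means of `ξ` above `ε`, but these tend
to `0`. -/
theorem tendsto_act {P : Matrix ℕ ℕ ℝ} (hP : P ∈ substochastic) {ξ : ℕ → ℝ} (hξ : ξ ∈ c0Star) :
    Tendsto (act P ξ) atTop (𝓝 0) := by
  have hfin : ∀ ε : ℝ, 0 < ε → {i | ε ≤ act P ξ i}.Finite := by
    intro ε hε
    by_contra hinf
    have hle : ∀ n, ε ≤ arithMean ξ n := by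
      intro n
      obtain ⟨F, hF, hFc⟩ := Set.Infinite.exists_subset_card_eq hinf (n + 1)
      have h1 := sum_act_le hP hξ F hFc.le
      have h2 := Finset.card_nsmul_le_sum F (act P ξ) ε fun i hi => hF hi
      rw [hFc, nsmul_eq_mul] at h2
      rw [arithMean, le_div_iff₀ (by positivity)]
      push_cast at h2
      linarith
    exact absurd (ge_of_tendsto' (arithMean_mem_c0Star hξ).2.2 hle) (not_le.mpr hε)
  rw [← Nat.cofinite_eq_atTop, Metric.tendsto_nhds]
  intro ε hε
  rw [eventually_cofinite]
  refine (hfin ε hε).subset fun i hi => ?_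
  rw [Set.mem_ofPred_eq, Real.dist_eq, sub_zero, abs_of_nonneg (act_nonneg hP.1 hξ.1 i)] at hi
  exact not_lt.mp hi

theorem arithMean_rearrangement_act_le {P : Matrix ℕ ℕ ℝ} (hP : P ∈ substochastic) {ξ : ℕ → ℝ}
    (hξ : ξ ∈ c0Star) (n : ℕ) :
    arithMean (rearrangement (act P ξ)) n ≤ arithMean ξ n := by
  obtain ⟨F, hF, h⟩ := exists_finset_sum_rearrangement_le (tendsto_act hP hξ) (n + 1)
  exact div_le_div_of_nonneg_right (h.trans (sum_act_le hP hξ F hF)) (by positivity)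

section Operators

variable {H : Type*} [NormedAddCommGroup H] [InnerProductSpace ℂ H] [CompleteSpace H]

/-! ### Diagonalization of compact operators -/

/-- The eigenspace is spanned by the basis vectors with `ρ n = t`, finitely many since `t > 0`. -/
theorem IsDiag.toENat_rank_eigenspace {b : HilbertBasis ℕ ℂ H} {ρ : ℕ → ℝ} {D : H →L[ℂ] H}
    (hD : IsDiag b ρ D) (hρ : Tendsto ρ atTop (𝓝 0)) {t : ℝ} (ht : 0 < t) :
    Cardinal.toENat (Module.rank ℂ (Module.End.eigenspace D.toLinearMap (t : ℂ))) =
      {n | ρ n = t}.encard := by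
  have hf : {n | ρ n = t}.Finite :=
    (finite_lt_of_tendsto_zero hρ (half_pos ht)).subset fun n hn => by
      rw [Set.mem_ofPred_eq] at hn ⊢
      rw [hn]
      exact half_lt_self ht
  have hspan : Module.End.eigenspace D.toLinearMap (t : ℂ) =
      Submodule.span ℂ (b '' {n | ρ n = t}) := by
    apply le_antisymm
    · intro v hv
      rw [Module.End.mem_eigenspace_iff] at hv
      change D v = _ at hv
      have h0 : ∀ n, ρ n ≠ t → inner ℂ (b n) v = 0 := by
        intro n hn
        have h := hD.inner_apply n v
        rw [hv, inner_smul_right] at h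
        by_contra hne
        exact hn (by exact_mod_cast (mul_right_cancel₀ hne h).symm)
      have hv' : v = ∑ n ∈ hf.toFinset, inner ℂ (b n) v • b n := by
        refine eq_of_inner_basis b fun m => ?_
        rw [inner_sum]
        simp only [inner_smul_right, inner_basis, mul_ite, mul_one, mul_zero, Finset.sum_ite_eq,
          Set.Finite.mem_toFinset, Set.mem_ofPred_eq]
        split_ifs with h
        · rfl
        · exact h0 m h
      rw [hv']
      refine Submodule.sum_mem _ fun n hn => Submodule.smul_mem _ _ (Submodule.subset_span ?_)
      exact ⟨n, by simpa using hn, rfl⟩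
    · rw [Submodule.span_le]
      rintro _ ⟨n, hn, rfl⟩
      rw [SetLike.mem_coe, Module.End.mem_eigenspace_iff]
      rw [Set.mem_ofPred_eq] at hn
      rw [← hn]
      exact hD n
  have hli := b.orthonormal.linearIndependent
  rw [hspan, rank_span_set ((hli.linearIndepOn _).id_image), ← hli.injective.encard_image]
  rfl

theorem isDiag_abs {X : H →L[ℂ] H} {b : HilbertBasis ℕ ℂ H} {ρ : ℕ → ℝ} (hρ : ∀ n, 0 ≤ ρ n)
    (h : ∀ n, (star X * X) (b n) = ((ρ n ^ 2 : ℝ) : ℂ) • b n) : IsDiag b ρ (CFC.abs X) := by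
  have hb : ∀ n, |ρ n| ≤ √‖star X * X‖ := fun n => by
    refine Real.abs_le_sqrt ?_
    have := (star X * X).le_opNorm (b n)
    rwa [h n, norm_smul, norm_basis, mul_one, mul_one, Complex.norm_real, Real.norm_eq_abs,
      abs_of_nonneg (sq_nonneg _)] at this
  obtain ⟨D, -, hD⟩ := exists_isDiag b ρ _ hb
  have : CFC.abs X = D := by
    refine CFC.sqrt_unique ?_ (hD.nonneg hρ)
    refine clm_ext_basis b fun n => ?_
    rw [hD.mul hD n, h n, sq]
  rwa [this]

theorem inner_apply_apply (X : H →L[ℂ] H) (x y : H) :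
    inner ℂ (X x) (X y) = inner ℂ x ((star X * X) y) := by
  rw [mul_apply_eq_comp, ContinuousLinearMap.star_eq_adjoint,
    ContinuousLinearMap.adjoint_inner_right]

/-- `X* X = |X|²`, so `X` maps an eigenbasis of `|X|` to an orthogonal sequence. -/
theorem IsDiag.inner_of_abs {X : H →L[ℂ] H} {b : HilbertBasis ℕ ℂ H} {ρ : ℕ → ℝ}
    (h : IsDiag b ρ (CFC.abs X)) (m n : ℕ) :
    inner ℂ (X (b m)) (X (b n)) = if m = n then ((ρ n * ρ n : ℝ) : ℂ) else 0 := by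
  rw [inner_apply_apply, ← CFC.abs_mul_abs, h.mul h n, inner_smul_right, inner_basis]
  split_ifs <;> simp

/-- The basis tends weakly to `0`, and compactness upgrades this to norm convergence of the images
along subsequences. -/
theorem IsCompactOperator.tendsto_basis {X : H →L[ℂ] H} (hX : IsCompactOperator X)
    (b : HilbertBasis ℕ ℂ H) : Tendsto (fun n => X (b n)) atTop (𝓝 0) := by
  have hweak : ∀ z : H, Tendsto (fun n => inner ℂ (b n) z) atTop (𝓝 0) := by
    intro z
    have h1 := (b.orthonormal.inner_products_summable z).tendsto_atTop_zero
    rw [tendsto_zero_iff_norm_tendsto_zero]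
    have h2 := h1.sqrt
    simpa [Real.sqrt_sq] using h2
  have hK := hX.isCompact_closure_image_closedBall (f := X.toLinearMap) 1
  refine tendsto_of_subseq_tendsto fun ns hns => ?_
  have hmem : ∀ n, X (b (ns n)) ∈ closure (X.toLinearMap '' Metric.closedBall 0 1) := fun n =>
    subset_closure ⟨b (ns n), by simp [norm_basis], rfl⟩
  obtain ⟨y, -, φ, hφ, hy⟩ := hK.tendsto_subseq hmem
  have hy0 : y = 0 := by
    have h1 : Tendsto (fun n => inner ℂ (X (b (ns (φ n)))) y) atTop (𝓝 (inner ℂ y y)) :=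
      hy.inner tendsto_const_nhds
    have h2 : Tendsto (fun n => inner ℂ (X (b (ns (φ n)))) y) atTop (𝓝 0) := by
      have := (hweak (star X y)).comp (hns.comp hφ.tendsto_atTop)
      refine this.congr fun n => ?_
      simp only [Function.comp]
      rw [ContinuousLinearMap.star_eq_adjoint, ContinuousLinearMap.adjoint_inner_right]
    exact inner_self_eq_zero.mp (tendsto_nhds_unique h1 h2)
  exact ⟨φ, by rw [← hy0]; exact hy⟩

/-- Each `v i` meets some `e n`, and by Bessel each `e n` meets only countably many `v i`. -/
theorem countable_of_orthonormal (e : HilbertBasis ℕ ℂ H) {ι : Type*} {v : ι → H}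
    (hv : Orthonormal ℂ v) : Countable ι := by
  rw [← Set.countable_univ_iff]
  have : (Set.univ : Set ι) ⊆ ⋃ n, Function.support fun i => ‖inner ℂ (v i) (e n)‖ ^ 2 := by
    intro i _
    rw [Set.mem_iUnion]
    by_contra! h
    have h0 : v i = 0 := eq_of_inner_basis e fun n => by
      have := h n
      rw [Function.notMem_support, sq_eq_zero_iff, norm_eq_zero] at this
      rw [← inner_conj_symm, this]
      simp
    have := hv.1 i
    rw [h0] at this
    simp at this
  exact (Set.countable_iUnion fun n =>
    (hv.inner_products_summable (e n)).countable_support).mono this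

theorem infinite_of_orthogonal_eq_bot (e : HilbertBasis ℕ ℂ H) {ι : Type*} {v : ι → H}
    (hsp : (Submodule.span ℂ (Set.range v))ᗮ = ⊥) : Infinite ι := by
  by_contra hfin
  rw [not_infinite_iff_finite] at hfin
  have hfd : FiniteDimensional ℂ (Submodule.span ℂ (Set.range v)) :=
    FiniteDimensional.span_of_finite ℂ (Set.finite_range v)
  rw [Submodule.orthogonal_eq_bot_iff] at hsp
  have : Module.Finite ℂ H := by
    rw [Module.finite_def, ← hsp]
    exact (Submodule.fg_iff_finiteDimensional _).mpr hfd
  exact Infinite.not_finite e.orthonormal.linearIndependent.finite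

theorem exists_hilbertBasis_nat (e : HilbertBasis ℕ ℂ H) {ι : Type*} {v : ι → H}
    (hv : Orthonormal ℂ v) (hsp : (Submodule.span ℂ (Set.range v))ᗮ = ⊥) :
    ∃ (b : HilbertBasis ℕ ℂ H) (f : ℕ → ι), ∀ n, b n = v (f n) := by
  have := countable_of_orthonormal e hv
  have := infinite_of_orthogonal_eq_bot e hsp
  obtain ⟨hd⟩ := nonempty_denumerable ι
  let f : ℕ ≃ ι := (Denumerable.eqv ι).symm
  have hr : Set.range (v ∘ f) = Set.range v := f.surjective.range_comp v
  refine ⟨HilbertBasis.mkOfOrthogonalEqBot (hv.comp f f.injective) (by rw [hr]; exact hsp), f, ?_⟩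
  intro n
  rw [HilbertBasis.coe_mkOfOrthogonalEqBot]
  rfl

/-- Orthonormal bases of all eigenspaces, the kernel included, are glued together and re-enumerated
by `ℕ`. -/
theorem exists_eigenbasis (e : HilbertBasis ℕ ℂ H) {T : H →L[ℂ] H} (hT : IsCompactOperator T)
    (hT' : T.IsSymmetric) :
    ∃ (b : HilbertBasis ℕ ℂ H) (μ : ℕ → ℂ), ∀ n, T (b n) = μ n • b n := by
  have hc : ∀ μ, CompleteSpace (Module.End.eigenspace (T : Module.End ℂ H) μ) := by
    intro μ
    have : IsClosed (Module.End.eigenspace (T : Module.End ℂ H) μ : Set H) := by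
      have h : (Module.End.eigenspace (T : Module.End ℂ H) μ : Set H) =
          {x | T x = μ • x} := by
        ext x
        exact Module.End.mem_eigenspace_iff
      rw [h]
      exact isClosed_eq T.continuous (continuous_const_smul μ)
    exact this.completeSpace_coe
  choose w B hB using fun μ => exists_hilbertBasis ℂ (Module.End.eigenspace (T : Module.End ℂ H) μ)
  have hv := (LinearMap.IsSymmetric.orthogonalFamily_eigenspaces hT').orthonormal_sigma_orthonormal
    (fun μ => (B μ).orthonormal)
  obtain ⟨b, f, hb⟩ := exists_hilbertBasis_nat e hv (by
    rw [eq_bot_iff, ← ContinuousLinearMap.orthogonalComplement_iSup_eigenspaces_eq_bot hT hT']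
    intro x hx
    rw [Submodule.mem_orthogonal'] at hx
    have hle : (⨆ μ, Module.End.eigenspace (T : Module.End ℂ H) μ) ≤ (Submodule.span ℂ {x})ᗮ := by
      refine iSup_le fun μ y hy => ?_
      rw [Submodule.mem_orthogonal_singleton_iff_inner_right]
      have h1 := ((B μ).hasSum_repr ⟨y, hy⟩).mapL
        ((innerSL ℂ x).comp (Module.End.eigenspace (T : Module.End ℂ H) μ).subtypeL)
      have h2 : ∀ i, ((innerSL ℂ x).comp (Module.End.eigenspace (T : Module.End ℂ H) μ).subtypeL)
          ((B μ).repr ⟨y, hy⟩ i • B μ i) = 0 := by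
        intro i
        rw [map_smul]
        have := hx _ (Submodule.subset_span ⟨⟨μ, i⟩, rfl⟩)
        change _ • inner ℂ x ((B μ i : Module.End.eigenspace (T : Module.End ℂ H) μ) : H) = 0
        rw [show inner ℂ x ((B μ i : Module.End.eigenspace (T : Module.End ℂ H) μ) : H) = 0
          from this, smul_zero]
      simp only [h2] at h1
      exact h1.unique hasSum_zero
    exact Submodule.orthogonal_le hle
      (Submodule.le_orthogonal_orthogonal _ (Submodule.mem_span_singleton_self x)))
  refine ⟨b, fun n => (f n).1, fun n => ?_⟩
  rw [hb n]
  exact Module.End.mem_eigenspace_iff.mp (B (f n).1 (f n).2).2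

theorem IsCompactOperator.exists_isDiag_abs (e : HilbertBasis ℕ ℂ H) {X : H →L[ℂ] H}
    (hX : IsCompactOperator X) : ∃ (b : HilbertBasis ℕ ℂ H) (ρ : ℕ → ℝ), (∀ n, 0 ≤ ρ n) ∧
      Tendsto ρ atTop (𝓝 0) ∧ IsDiag b ρ (CFC.abs X) := by
  have hc : IsCompactOperator (star X * X) := hX.clm_comp (star X)
  have hs : (star X * X).IsSymmetric := (IsSelfAdjoint.star_mul_self X).isSymmetric
  obtain ⟨b, μ, hb⟩ := exists_eigenbasis e hc hs
  -- The eigenvalue of `X* X` at `b n` is `‖X (b n)‖²`.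
  refine ⟨b, fun n => ‖X (b n)‖, fun n => norm_nonneg _, ?_, ?_⟩
  · simpa using (IsCompactOperator.tendsto_basis hX b).norm
  · refine isDiag_abs (fun n => norm_nonneg _) fun n => ?_
    have h := inner_apply_apply X (b n) (b n)
    rw [hb n, inner_smul_right, inner_self_eq_norm_sq_to_K, inner_self_eq_norm_sq_to_K,
      norm_basis] at h
    rw [hb n]
    congr 1
    simpa using h.symm

theorem IsDiag.isSNumbers_of_abs {X : H →L[ℂ] H} (hX : IsCompactOperator X)
    {b : HilbertBasis ℕ ℂ H} {ρ : ℕ → ℝ} (hρ : Tendsto ρ atTop (𝓝 0))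
    (h : IsDiag b ρ (CFC.abs X)) : IsSNumbers X (rearrangement ρ) := by
  refine ⟨hX, rearrangement_mem_c0Star hρ, fun t ht => ?_⟩
  rw [h.toENat_rank_eigenspace hρ ht, encard_eq_rearrangement hρ ht]

theorem IsDiag.isSNumbers {b : HilbertBasis ℕ ℂ H} {ξ : ℕ → ℝ} {D : H →L[ℂ] H}
    (hD : IsDiag b ξ D) (hξ : ξ ∈ c0Star) : IsSNumbers D ξ := by
  refine ⟨hD.isCompactOperator hξ.2.2, hξ, fun t ht => ?_⟩
  rw [CFC.abs_of_nonneg D (hD.nonneg hξ.1), hD.toENat_rank_eigenspace hξ.2.2 ht]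

theorem IsCompactOperator.exists_isSNumbers (e : HilbertBasis ℕ ℂ H) {X : H →L[ℂ] H}
    (hX : IsCompactOperator X) : ∃ ξ, IsSNumbers X ξ := by
  obtain ⟨b, ρ, -, hρ, h⟩ := IsCompactOperator.exists_isDiag_abs e hX
  exact ⟨_, h.isSNumbers_of_abs hX hρ⟩

/-! ### Diagonal operators in ideals -/

/-- `diag ρ` belongs to the ideal `I`. -/
def DiagMem (e : HilbertBasis ℕ ℂ H) (I : TwoSidedIdeal (H →L[ℂ] H)) (ρ : ℕ → ℝ) : Prop :=
  ∃ D ∈ I, IsDiag e ρ D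

variable {e : HilbertBasis ℕ ℂ H} {I : TwoSidedIdeal (H →L[ℂ] H)}

theorem IsDiag.mem_iff {ρ : ℕ → ℝ} {D : H →L[ℂ] H} (hD : IsDiag e ρ D) :
    D ∈ I ↔ DiagMem e I ρ :=
  ⟨fun h => ⟨D, h, hD⟩, fun ⟨_, hE, hE'⟩ => by rwa [hD.unique hE']⟩

theorem DiagMem.mono {ρ σ : ℕ → ℝ} (hσ : DiagMem e I σ) {M : ℝ} (h : ∀ n, |ρ n| ≤ M * |σ n|) :
    DiagMem e I ρ := by
  obtain ⟨D, hDI, hD⟩ := hσ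
  -- Where `σ n = 0` the quotient is `0` by convention, and `h` forces `ρ n = 0` too.
  obtain ⟨E, -, hE⟩ := exists_isDiag e (fun n => ρ n / σ n) |M| fun n => by
    by_cases h0 : σ n = 0
    · simp [h0]
    · rw [abs_div, div_le_iff₀ (abs_pos.mpr h0)]
      exact (h n).trans (mul_le_mul_of_nonneg_right (le_abs_self M) (abs_nonneg _))
  refine ⟨E * D, I.mul_mem_left _ _ hDI, ?_⟩
  have := hE.mul hD
  convert this using 2 with n
  by_cases h0 : σ n = 0
  · have := h n
    rw [h0, abs_zero, mul_zero] at this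
    simp [h0, abs_nonpos_iff.mp this]
  · field_simp

theorem DiagMem.add {ρ σ : ℕ → ℝ} (hρ : DiagMem e I ρ) (hσ : DiagMem e I σ) :
    DiagMem e I fun n => ρ n + σ n := by
  obtain ⟨D, hDI, hD⟩ := hρ
  obtain ⟨E, hEI, hE⟩ := hσ
  exact ⟨D + E, I.add_mem hDI hEI, hD.add hE⟩

/-- Membership of diagonal operators passes to rearrangements along partial injections. -/
theorem DiagMem.comp {ρ ξ : ℕ → ℝ} (hρ : DiagMem e I ρ) {S : Set ℕ} {f : ℕ → ℕ}
    (hf : Set.InjOn f S) (hS : ∀ n ∈ S, ρ (f n) = ξ n) (hS' : ∀ n ∉ S, ξ n = 0) :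
    DiagMem e I ξ := by
  classical
  obtain ⟨D, hDI, hD⟩ := hρ
  have hw : ∀ i j, inner ℂ (if i ∈ S then e (f i) else 0) (if j ∈ S then e (f j) else 0) =
      if i = j ∧ i ∈ S then (1 : ℂ) else 0 := by
    intro i j
    by_cases hi : i ∈ S <;> by_cases hj : j ∈ S
    · by_cases hij : i = j
      · simp [hij, hj, norm_basis]
      · have : f i ≠ f j := fun h => hij (hf hi hj h)
        simp [hi, hj, hij, inner_basis, this]
    · have : i ≠ j := by rintro rfl; exact hj hi
      simp [hj, this]
    · simp [hi]
    · simp [hi]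
  -- `W` is the partial isometry implementing `f` on `S`, so `W* D W` is `diag ξ`.
  obtain ⟨W, -, hW⟩ := exists_clm_basis e (fun n => if n ∈ S then e (f n) else 0)
    (fun i j hij => by rw [hw]; simp [hij]) 1 (fun n => by
      split_ifs <;> simp [norm_basis])
  refine ⟨star W * (D * W), I.mul_mem_left _ _ (I.mul_mem_right _ _ hDI), fun n => ?_⟩
  refine eq_of_inner_basis e fun m => ?_
  have h1 : D (W (e n)) = (ξ n : ℂ) • W (e n) := by
    rw [hW n]
    split_ifs with h
    · rw [hD, hS n h]
    · simp
  rw [mul_apply_eq_comp, mul_apply_eq_comp, ContinuousLinearMap.star_eq_adjoint,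
    ContinuousLinearMap.adjoint_inner_right, h1, inner_smul_right, inner_smul_right, hW, hW, hw,
    inner_basis]
  by_cases hmn : m = n
  · by_cases hm : n ∈ S
    · simp [hmn, hm]
    · simp [hmn, hm, hS' n hm]
  · simp [hmn]

theorem DiagMem.of_encard_le {ρ ξ : ℕ → ℝ} (hρ : DiagMem e I ρ) (hξ0 : ∀ n, 0 ≤ ξ n)
    (hξ : Tendsto ξ atTop (𝓝 0))
    (h : ∀ t : ℝ, 0 < t → {n | ξ n = t}.encard ≤ {n | ρ n = t}.encard) : DiagMem e I ξ := by
  obtain ⟨f, hf, hfρ⟩ := exists_injOn_of_encard_le hξ h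
  exact hρ.comp hf hfρ fun n hn => le_antisymm (not_lt.mp hn) (hξ0 n)

/-- The singular value decomposition: an operator and its diagonalized modulus generate the same
ideal. -/
theorem IsDiag.mem_iff_of_abs {X : H →L[ℂ] H} {b : HilbertBasis ℕ ℂ H} {ρ : ℕ → ℝ}
    (h : IsDiag b ρ (CFC.abs X)) : X ∈ I ↔ DiagMem e I ρ := by
  have hin := h.inner_of_abs
  -- `U` is the polar part of `X` written from `e`; `0⁻¹ = 0` handles the kernel. With `V` taking
  -- `e` to `b`, one has `X = U D V*` and `D = U* X V`.
  obtain ⟨U, -, hU⟩ := exists_clm_basis e (fun n => ((ρ n : ℂ)⁻¹) • X (b n))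
    (fun i j hij => by
      rw [inner_smul_left, inner_smul_right, hin, if_neg hij, mul_zero, mul_zero]) 1 (fun n => by
      have h1 : ‖X (b n)‖ = |ρ n| := by
        have := hin n n
        rw [if_pos rfl, inner_self_eq_norm_sq_to_K] at this
        have h2 : ‖X (b n)‖ ^ 2 = ρ n * ρ n := by
          apply Complex.ofReal_injective
          simpa using this
        rw [← sq, ← sq_abs (ρ n)] at h2
        exact (sq_eq_sq₀ (norm_nonneg _) (abs_nonneg _)).mp h2
      rw [norm_smul, h1, norm_inv, Complex.norm_real, Real.norm_eq_abs]
      exact inv_mul_le_one)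
  obtain ⟨V, -, hV⟩ := exists_clm_basis e (fun n => b n)
    (fun i j hij => by rw [inner_basis, if_neg hij]) 1 (fun n => (norm_basis b n).le)
  obtain ⟨D, -, hD⟩ := exists_isDiag e ρ ‖CFC.abs X‖ (fun n => by
    have := (CFC.abs X).le_opNorm (b n)
    rwa [h n, norm_smul, norm_basis, mul_one, mul_one, Complex.norm_real] at this)
  have hVb : ∀ n, star V (b n) = e n := fun n => eq_of_inner_basis e fun m => by
    rw [ContinuousLinearMap.star_eq_adjoint, ContinuousLinearMap.adjoint_inner_right, hV,
      inner_basis, inner_basis]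
  have h1 : U * (D * star V) = X := by
    refine clm_ext_basis b fun n => ?_
    rw [mul_apply_eq_comp, mul_apply_eq_comp, hVb, hD, map_smul, hU, smul_smul]
    by_cases h0 : ρ n = 0
    · have := hin n n
      rw [if_pos rfl, h0, mul_zero, Complex.ofReal_zero, inner_self_eq_zero] at this
      simp [this]
    · rw [mul_inv_cancel₀ (by exact_mod_cast h0), one_smul]
  have h2 : star U * (X * V) = D := by
    refine clm_ext_basis e fun n => eq_of_inner_basis e fun m => ?_
    rw [mul_apply_eq_comp, mul_apply_eq_comp, hV, ContinuousLinearMap.star_eq_adjoint,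
      ContinuousLinearMap.adjoint_inner_right, hU, inner_smul_left, hin, hD, inner_smul_right,
      inner_basis]
    by_cases hmn : m = n
    · subst hmn
      by_cases h0 : ρ m = 0
      · simp [h0]
      · have : (ρ m : ℂ) ≠ 0 := by exact_mod_cast h0
        simp
        field_simp
    · simp [hmn]
  constructor
  · intro hX
    exact ⟨D, h2 ▸ I.mul_mem_left _ _ (I.mul_mem_right _ _ hX), hD⟩
  · intro hX
    rw [← h1]
    exact I.mul_mem_left _ _ (I.mul_mem_right _ _ (hD.mem_iff.mpr hX))

/-- The s-numbers and the eigenvalues along an eigenbasis share all positive multiplicities; their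
numbers of zeros may differ, which does not affect membership. -/
theorem IsSNumbers.mem_iff {X : H →L[ℂ] H} {ξ : ℕ → ℝ} (h : IsSNumbers X ξ) :
    X ∈ I ↔ DiagMem e I ξ := by
  obtain ⟨hX, hξ, hfib⟩ := h
  obtain ⟨b, ρ, hρ0, hρ, hD⟩ := IsCompactOperator.exists_isDiag_abs e hX
  have heq : ∀ t : ℝ, 0 < t → {n | ξ n = t}.encard = {n | ρ n = t}.encard := fun t ht => by
    rw [hfib t ht, hD.toENat_rank_eigenspace hρ ht]
  rw [hD.mem_iff_of_abs (e := e)]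
  exact ⟨fun h => h.of_encard_le hξ.1 hξ.2.2 fun t ht => (heq t ht).le,
    fun h => h.of_encard_le hρ0 hρ fun t ht => (heq t ht).ge⟩

theorem mem_charSet_iff (e : HilbertBasis ℕ ℂ H) {ξ : ℕ → ℝ} :
    ξ ∈ charSet I ↔ ξ ∈ c0Star ∧ DiagMem e I ξ := by
  constructor
  · rintro ⟨X, hX, hξ⟩
    exact ⟨hξ.2.1, hξ.mem_iff.mp hX⟩
  · rintro ⟨hξ, D, hDI, hD⟩
    exact ⟨D, hDI, hD.isSNumbers hξ⟩

theorem rearrangement_mem_charSet_iff (e : HilbertBasis ℕ ℂ H) {ρ : ℕ → ℝ} (hρ0 : ∀ n, 0 ≤ ρ n)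
    (hρ : Tendsto ρ atTop (𝓝 0)) : rearrangement ρ ∈ charSet I ↔ DiagMem e I ρ := by
  have hc := rearrangement_mem_c0Star hρ
  rw [mem_charSet_iff e, and_iff_right hc]
  exact ⟨fun h => h.of_encard_le hρ0 hρ fun t ht => (encard_eq_rearrangement hρ ht).ge,
    fun h => h.of_encard_le hc.1 hc.2.2 fun t ht => (encard_eq_rearrangement hρ ht).le⟩

/-! ### Proper ideals consist of compact operators -/

/-- `X` composed with the projection onto `V` is compact, so what `X` does on `Vᗮ` must still have
norm above `ε`. -/
theorem exists_unit_vector_orthogonal {X : H →L[ℂ] H} {ε : ℝ}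
    (hε : ∀ F : H →L[ℂ] H, IsCompactOperator F → ε < ‖X - F‖) (hε0 : 0 < ε)
    (V : Submodule ℂ H) [FiniteDimensional ℂ V] :
    ∃ v ∈ Vᗮ, ‖v‖ = 1 ∧ ε < ‖X v‖ := by
  let F : H →L[ℂ] H := X * V.starProjection
  have hF : IsCompactOperator F := by
    have hp : IsCompactOperator V.starProjection := by
      refine isCompactOperator_of_finiteDimensional_range _ ?_
      have : LinearMap.range V.starProjection.toLinearMap ≤ V := by
        rintro _ ⟨x, rfl⟩
        exact V.starProjection_apply_mem x
      exact Submodule.finiteDimensional_of_le this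
    exact hp.clm_comp X
  obtain ⟨x, hx⟩ : ∃ x, ε * ‖x‖ < ‖(X - F) x‖ := by
    by_contra! h
    exact absurd (ContinuousLinearMap.opNorm_le_bound _ hε0.le h) (not_le.mpr (hε F hF))
  set y := x - V.starProjection x with hy
  have hyV : y ∈ Vᗮ := V.sub_starProjection_mem_orthogonal x
  have hXy : (X - F) x = X y := by
    rw [hy, map_sub]
    rfl
  have hyx : ‖y‖ ≤ ‖x‖ := by
    have h : y = Vᗮ.starProjection x := by
      rw [Submodule.starProjection_orthogonal]
      rfl
    rw [h]
    exact Submodule.norm_starProjection_apply_le _ _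
  rw [hXy] at hx
  have hlt : ε * ‖y‖ < ‖X y‖ := lt_of_le_of_lt (by gcongr) hx
  have hy0 : 0 < ‖y‖ := by
    rw [norm_pos_iff]
    rintro h0
    rw [h0] at hlt
    simp at hlt
  refine ⟨((‖y‖⁻¹ : ℝ) : ℂ) • y, Submodule.smul_mem _ _ hyV, ?_, ?_⟩
  · rw [norm_smul, Complex.norm_real, norm_inv, norm_norm, inv_mul_cancel₀ hy0.ne']
  · rw [map_smul, norm_smul, Complex.norm_real, norm_inv, norm_norm, inv_mul_eq_div,
      lt_div_iff₀ hy0]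
    exact hlt

/-- A noncompact `X` is bounded below on an orthonormal sequence with orthogonal images, so the
identity factors through `X`. -/
theorem eq_top_of_not_isCompactOperator (e : HilbertBasis ℕ ℂ H) {I : TwoSidedIdeal (H →L[ℂ] H)}
    {X : H →L[ℂ] H} (hX : X ∈ I) (hc : ¬ IsCompactOperator X) : I = ⊤ := by
  obtain ⟨ε, hε0, hε⟩ : ∃ ε > 0, ∀ F : H →L[ℂ] H, IsCompactOperator F → ε < ‖X - F‖ := by
    by_contra! h
    choose F hF hXF using fun n : ℕ => h (1 / ((n : ℝ) + 1)) (by positivity)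
    refine hc (isCompactOperator_of_tendsto (l := atTop) (F := F) (f := X) ?_
      (Eventually.of_forall hF))
    rw [tendsto_iff_norm_sub_tendsto_zero]
    refine squeeze_zero (fun _ => norm_nonneg _) (fun n => ?_)
      (tendsto_one_div_add_atTop_nhds_zero_nat (𝕜 := ℝ))
    rw [norm_sub_rev]
    exact hXF n
  obtain ⟨v, hv, hvv⟩ := exists_seq_of_forall_finset_exists
    (fun v : H => ‖v‖ = 1 ∧ ε < ‖X v‖)
    (fun v w => inner ℂ v w = 0 ∧ inner ℂ (X v) (X w) = 0) (by
      classical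
      intro s _
      -- Orthogonality to `X* X v` as well as to `v` makes the images under `X` orthogonal.
      obtain ⟨y, hy, hy1, hy2⟩ := exists_unit_vector_orthogonal hε hε0
        (Submodule.span ℂ ((s ∪ s.image (star X * X) : Finset H) : Set H))
      refine ⟨y, ⟨hy1, hy2⟩, fun x hx => ⟨?_, ?_⟩⟩
      · exact (Submodule.mem_orthogonal _ _).mp hy _ (Submodule.subset_span (by simp [hx]))
      · have := (Submodule.mem_orthogonal _ _).mp hy ((star X * X) x) (Submodule.subset_span (by
          rw [Finset.coe_union, Finset.coe_image]
          exact Or.inr ⟨x, hx, rfl⟩))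
        rw [← inner_conj_symm, inner_apply_apply, inner_conj_symm]
        exact this)
  have horth : ∀ i j, i ≠ j → inner ℂ (v i) (v j) = 0 ∧ inner ℂ (X (v i)) (X (v j)) = 0 := by
    intro i j hij
    rcases lt_or_gt_of_ne hij with h | h
    · exact hvv i j h
    · exact ⟨inner_eq_zero_symm.mp (hvv j i h).1, inner_eq_zero_symm.mp (hvv j i h).2⟩
  have hpos : ∀ n, 0 < ‖X (v n)‖ := fun n => hε0.trans (hv n).2
  obtain ⟨W, -, hW⟩ := exists_clm_basis e v (fun i j hij => (horth i j hij).1) 1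
    (fun n => (hv n).1.le)
  -- This scaling makes `Z* X W` the identity; the lower bound `ε` keeps `Z` bounded.
  obtain ⟨Z, -, hZ⟩ := exists_clm_basis e (fun n => (((‖X (v n)‖ ^ 2)⁻¹ : ℝ) : ℂ) • X (v n))
    (fun i j hij => by
      rw [inner_smul_left, inner_smul_right, (horth i j hij).2, mul_zero, mul_zero]) ε⁻¹
    (fun n => by
      have := hpos n
      rw [norm_smul, Complex.norm_real, norm_inv, norm_pow, norm_norm]
      rw [show (‖X (v n)‖ ^ 2)⁻¹ * ‖X (v n)‖ = ‖X (v n)‖⁻¹ by field_simp]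
      exact inv_anti₀ hε0 (hv n).2.le)
  have h1 : star Z * (X * W) = 1 := by
    refine clm_ext_basis e fun n => eq_of_inner_basis e fun m => ?_
    rw [mul_apply_eq_comp, mul_apply_eq_comp, hW, ContinuousLinearMap.star_eq_adjoint,
      ContinuousLinearMap.adjoint_inner_right, hZ, inner_smul_left, one_apply_eq_self,
      inner_basis]
    split_ifs with hmn
    · subst hmn
      have := (hpos m).ne'
      rw [inner_self_eq_norm_sq_to_K, Complex.conj_ofReal]
      rw [show (RCLike.ofReal ‖X (v m)‖ : ℂ) = ((‖X (v m)‖ : ℝ) : ℂ) from rfl,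
        ← Complex.ofReal_pow, ← Complex.ofReal_mul, inv_mul_cancel₀ (pow_ne_zero 2 this),
        Complex.ofReal_one]
    · rw [(horth m n hmn).2, mul_zero]
  have h2 : (1 : H →L[ℂ] H) ∈ I := h1 ▸ I.mul_mem_left _ _ (I.mul_mem_right _ _ hX)
  refine TwoSidedIdeal.ext fun x => ⟨fun _ => trivial, fun _ => ?_⟩
  have := I.mul_mem_left x 1 h2
  rwa [mul_one] at this

theorem eq_of_charSet_eq (e : HilbertBasis ℕ ℂ H) {I J : TwoSidedIdeal (H →L[ℂ] H)}
    (hI : ∀ X ∈ I, IsCompactOperator X) (hJ : ∀ X ∈ J, IsCompactOperator X)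
    (h : charSet I = charSet J) : I = J := by
  have key : ∀ I J : TwoSidedIdeal (H →L[ℂ] H), (∀ X ∈ I, IsCompactOperator X) →
      charSet I = charSet J → ∀ X ∈ I, X ∈ J := by
    intro I J hI h X hX
    obtain ⟨ξ, hξ⟩ := IsCompactOperator.exists_isSNumbers e (hI X hX)
    have h1 : ξ ∈ charSet J := h ▸ ⟨X, hX, hξ⟩
    exact (hξ.mem_iff (e := e)).mpr ((mem_charSet_iff e).mp h1).2
  exact TwoSidedIdeal.ext fun X => ⟨key I J hI h X, key J I hJ h.symm X⟩

/-! ### Characteristic sets -/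

/-- Nonempty, additive, hereditary (up to constants) subsets of `c0Star` that are invariant under
the ampliation repeating every entry twice. -/
structure IsCharSet (S : Set (ℕ → ℝ)) : Prop where
  subset : S ⊆ c0Star
  zero : 0 ∈ S
  mono : ∀ {ξ η : ℕ → ℝ}, ξ ∈ S → η ∈ c0Star → ∀ M : ℝ, (∀ n, η n ≤ M * ξ n) → η ∈ S
  add : ∀ {ξ η : ℕ → ℝ}, ξ ∈ S → η ∈ S → ξ + η ∈ S
  ampl : ∀ {ξ : ℕ → ℝ}, ξ ∈ S → (fun n => ξ (n / 2)) ∈ S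

theorem zero_mem_c0Star : (0 : ℕ → ℝ) ∈ c0Star :=
  ⟨fun _ => le_rfl, antitone_const, tendsto_const_nhds⟩

theorem add_mem_c0Star {ξ η : ℕ → ℝ} (hξ : ξ ∈ c0Star) (hη : η ∈ c0Star) : ξ + η ∈ c0Star :=
  ⟨fun n => add_nonneg (hξ.1 n) (hη.1 n), hξ.2.1.add hη.2.1,
    (add_zero (0 : ℝ)) ▸ hξ.2.2.add hη.2.2⟩

theorem const_mul_mem_c0Star {ξ : ℕ → ℝ} (hξ : ξ ∈ c0Star) {M : ℝ} (hM : 0 ≤ M) :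
    (fun n => M * ξ n) ∈ c0Star :=
  ⟨fun n => mul_nonneg hM (hξ.1 n), fun _ _ h => mul_le_mul_of_nonneg_left (hξ.2.1 h) hM, by
    simpa using hξ.2.2.const_mul M⟩

theorem ampl_mem_c0Star {ξ : ℕ → ℝ} (hξ : ξ ∈ c0Star) : (fun n => ξ (n / 2)) ∈ c0Star :=
  ⟨fun _ => hξ.1 _, fun _ _ h => hξ.2.1 (Nat.div_le_div_right h),
    hξ.2.2.comp (Nat.tendsto_div_const_atTop two_ne_zero)⟩

theorem IsCharSet.const_mul {S : Set (ℕ → ℝ)} (hS : IsCharSet S) {ξ : ℕ → ℝ} (hξ : ξ ∈ S) {M : ℝ}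
    (hM : 0 ≤ M) : (fun n => M * ξ n) ∈ S :=
  hS.mono hξ (const_mul_mem_c0Star (hS.subset hξ) hM) M fun _ => le_rfl

theorem isCharSet_charSet (e : HilbertBasis ℕ ℂ H) (I : TwoSidedIdeal (H →L[ℂ] H)) :
    IsCharSet (charSet I) where
  subset := fun ξ hξ => ((mem_charSet_iff e).mp hξ).1
  zero := (mem_charSet_iff e).mpr ⟨zero_mem_c0Star, 0, I.zero_mem, fun n => by simp⟩
  mono := by
    intro ξ η hξ hη M h
    rw [mem_charSet_iff e] at hξ ⊢
    refine ⟨hη, hξ.2.mono (M := M) fun n => ?_⟩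
    rw [abs_of_nonneg (hη.1 n), abs_of_nonneg (hξ.1.1 n)]
    exact h n
  add := by
    intro ξ η hξ hη
    rw [mem_charSet_iff e] at hξ hη ⊢
    exact ⟨add_mem_c0Star hξ.1 hη.1, hξ.2.add hη.2⟩
  ampl := by
    intro ξ hξ
    rw [mem_charSet_iff e] at hξ ⊢
    refine ⟨ampl_mem_c0Star hξ.1, ?_⟩
    -- The doubled sequence is the sum of copies of `ξ` on the even and the odd indices.
    have h1 : DiagMem e I fun n => if n % 2 = 0 then ξ (n / 2) else 0 :=
      hξ.2.comp (S := {n | n % 2 = 0}) (f := fun n => n / 2)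
        (fun a ha b hb h => by
          simp only [Set.mem_ofPred_eq] at ha hb h
          omega)
        (fun n hn => (if_pos hn).symm) (fun n hn => if_neg hn)
    have h2 : DiagMem e I fun n => if n % 2 = 1 then ξ (n / 2) else 0 :=
      hξ.2.comp (S := {n | n % 2 = 1}) (f := fun n => n / 2)
        (fun a ha b hb h => by
          simp only [Set.mem_ofPred_eq] at ha hb h
          omega)
        (fun n hn => (if_pos hn).symm) (fun n hn => if_neg hn)
    have h3 := h1.add h2
    convert h3 using 2 with n
    rcases Nat.mod_two_eq_zero_or_one n with h | h <;> simp [h]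

/-- The ideal of operators whose approximation numbers are dominated by an element of `S`. -/
def approxIdeal (S : Set (ℕ → ℝ)) (hS : IsCharSet S) : TwoSidedIdeal (H →L[ℂ] H) :=
  TwoSidedIdeal.mk' {X | ∃ ξ ∈ S, ∀ n : ℕ, ∃ F : H →L[ℂ] H, F.toLinearMap.rank ≤ n ∧ ‖X - F‖ ≤ ξ n}
    ⟨0, hS.zero, fun n => ⟨0, by
      simp [LinearMap.rank_zero], by simp⟩⟩
    (by
      rintro X Y ⟨ξ, hξ, hX⟩ ⟨η, hη, hY⟩
      -- Two approximants of rank `n / 2` add up to rank at most `n`; this is where ampliation is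
      -- needed.
      refine ⟨_, hS.ampl (hS.add hξ hη), fun n => ?_⟩
      obtain ⟨F, hF, hXF⟩ := hX (n / 2)
      obtain ⟨G, hG, hYG⟩ := hY (n / 2)
      refine ⟨F + G, ?_, ?_⟩
      · refine (LinearMap.rank_add_le F.toLinearMap G.toLinearMap).trans
          ((add_le_add hF hG).trans ?_)
        norm_cast
        omega
      · rw [add_sub_add_comm]
        exact (norm_add_le _ _).trans (add_le_add hXF hYG))
    (by
      rintro X ⟨ξ, hξ, hX⟩
      refine ⟨ξ, hξ, fun n => ?_⟩
      obtain ⟨F, hF, hXF⟩ := hX n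
      refine ⟨-F, ?_, ?_⟩
      · rwa [LinearMap.rank, show (-F).toLinearMap = -F.toLinearMap from rfl,
          LinearMap.range_neg]
      · rwa [← neg_sub', norm_neg])
    (by
      rintro A X ⟨ξ, hξ, hX⟩
      refine ⟨_, hS.const_mul hξ (norm_nonneg A), fun n => ?_⟩
      obtain ⟨F, hF, hXF⟩ := hX n
      refine ⟨A * F, (LinearMap.rank_comp_le_right F.toLinearMap A.toLinearMap).trans hF, ?_⟩
      rw [← mul_sub]
      exact (norm_mul_le _ _).trans (by gcongr))
    (by
      rintro X A ⟨ξ, hξ, hX⟩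
      refine ⟨_, hS.const_mul hξ (norm_nonneg A), fun n => ?_⟩
      obtain ⟨F, hF, hXF⟩ := hX n
      refine ⟨F * A, (LinearMap.rank_comp_le_left A.toLinearMap F.toLinearMap).trans hF, ?_⟩
      rw [← sub_mul, mul_comm ‖A‖]
      exact (norm_mul_le _ _).trans (by gcongr))

theorem mem_approxIdeal {S : Set (ℕ → ℝ)} {hS : IsCharSet S} {X : H →L[ℂ] H} :
    X ∈ approxIdeal S hS ↔
      ∃ ξ ∈ S, ∀ n : ℕ, ∃ F : H →L[ℂ] H, F.toLinearMap.rank ≤ n ∧ ‖X - F‖ ≤ ξ n :=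
  TwoSidedIdeal.mem_mk' _ _ _ _ _ _ _

theorem idealOf_le_approxIdeal (e : HilbertBasis ℕ ℂ H) {S : Set (ℕ → ℝ)} (hS : IsCharSet S) :
    idealOf e S ≤ approxIdeal S hS := by
  refine TwoSidedIdeal.span_le.mpr ?_
  rintro D ⟨ξ, hξ, hD⟩
  obtain ⟨h0, ha, -⟩ := hS.subset hξ
  refine mem_approxIdeal.mpr ⟨ξ, hξ, fun n => hD.exists_rank_le n (h0 n) fun k hk => ?_⟩
  rw [abs_of_nonneg (h0 k)]
  exact ha hk

/-- An operator of rank `n` kills a nonzero vector in the span of `e 0, …, e n`, where the quadratic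
form of `D` is at least `η n`. -/
theorem IsDiag.le_norm_sub {e : HilbertBasis ℕ ℂ H} {η : ℕ → ℝ} (hη : η ∈ c0Star) {D : H →L[ℂ] H}
    (hD : IsDiag e η D) {n : ℕ} {F : H →L[ℂ] H} (hF : F.toLinearMap.rank ≤ n) :
    η n ≤ ‖D - F‖ := by
  have hdep : ¬ LinearIndependent ℂ fun k : Fin (n + 1) =>
      (⟨F (e k), ⟨e k, rfl⟩⟩ : LinearMap.range F.toLinearMap) := by
    intro h
    have h1 := h.cardinal_lift_le_rank
    have h2 : Module.rank ℂ (LinearMap.range F.toLinearMap) ≤ n := hF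
    have h3 := h1.trans (Cardinal.lift_le.mpr h2)
    rw [Cardinal.mk_fin, Cardinal.lift_natCast, Cardinal.lift_natCast] at h3
    have : n + 1 ≤ n := by exact_mod_cast h3
    omega
  obtain ⟨c, hc, i, hi⟩ := Fintype.not_linearIndependent_iff.mp hdep
  have hc' : ∑ k, c k • F (e k) = 0 := by
    have := congrArg (Subtype.val) hc
    simpa using this
  set x : H := ∑ k : Fin (n + 1), c k • e k with hx
  have hFx : F x = 0 := by
    rw [hx, map_sum]
    simpa only [map_smul] using hc'
  have hon : Orthonormal ℂ fun k : Fin (n + 1) => e k :=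
    e.orthonormal.comp _ Fin.val_injective
  have hDx : D x = ∑ k : Fin (n + 1), (c k * η k) • e k := by
    rw [hx, map_sum]
    refine Finset.sum_congr rfl fun k _ => ?_
    rw [map_smul, hD, smul_smul]
  have hnx : ‖x‖ ^ 2 = ∑ k, ‖c k‖ ^ 2 := by
    have := hon.inner_sum c c Finset.univ
    rw [← hx, inner_self_eq_norm_sq_to_K] at this
    apply Complex.ofReal_injective
    push_cast
    rw [show ((‖x‖ : ℂ) ^ 2) = _ from this]
    refine Finset.sum_congr rfl fun k _ => ?_
    rw [← Complex.conj_mul']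
  have hin : inner ℂ x ((D - F) x) = ((∑ k : Fin (n + 1), η k * ‖c k‖ ^ 2 : ℝ) : ℂ) := by
    rw [sub_apply, hFx, sub_zero, hDx, hx, hon.inner_sum c _ Finset.univ]
    push_cast
    refine Finset.sum_congr rfl fun k _ => ?_
    rw [← Complex.conj_mul']
    ring
  have hxpos : 0 < ‖x‖ := by
    have : 0 < ‖x‖ ^ 2 := by
      rw [hnx]
      exact Finset.sum_pos' (fun _ _ => sq_nonneg _)
        ⟨i, Finset.mem_univ _, by have := norm_pos_iff.mpr hi; positivity⟩
    refine (norm_nonneg x).lt_of_ne fun h0 => ?_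
    rw [← h0] at this
    simp at this
  have h1 : η n * ‖x‖ ^ 2 ≤ ∑ k : Fin (n + 1), η k * ‖c k‖ ^ 2 := by
    rw [hnx, Finset.mul_sum]
    refine Finset.sum_le_sum fun k _ => ?_
    have := hη.2.1 (Nat.lt_succ_iff.mp k.2)
    gcongr
  have h2 : ∑ k : Fin (n + 1), η k * ‖c k‖ ^ 2 ≤ ‖D - F‖ * ‖x‖ ^ 2 := by
    have h3 := norm_inner_le_norm (𝕜 := ℂ) x ((D - F) x)
    rw [hin, Complex.norm_real] at h3
    have h4 := mul_le_mul_of_nonneg_left ((D - F).le_opNorm x) (norm_nonneg x)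
    have h5 := Real.le_norm_self (∑ k : Fin (n + 1), η k * ‖c k‖ ^ 2)
    linarith [sq ‖x‖, mul_comm (‖x‖) (‖D - F‖ * ‖x‖), mul_assoc ‖D - F‖ ‖x‖ ‖x‖]
  exact le_of_mul_le_mul_right (h1.trans h2) (by positivity)

/-- The ideal `approxIdeal S` contains the generators, and the approximation numbers of `diag η` are
at least `η`, so no new sequence appears. -/
theorem charSet_idealOf (e : HilbertBasis ℕ ℂ H) {S : Set (ℕ → ℝ)} (hS : IsCharSet S) :
    charSet (idealOf e S) = S := by
  ext η
  rw [mem_charSet_iff e]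
  constructor
  · rintro ⟨hη, D, hDI, hD⟩
    obtain ⟨ξ, hξ, h⟩ := mem_approxIdeal.mp (idealOf_le_approxIdeal e hS hDI)
    refine hS.mono hξ hη 1 fun n => ?_
    obtain ⟨F, hF, hDF⟩ := h n
    rw [one_mul]
    exact (hD.le_norm_sub hη hF).trans hDF
  · intro hη
    have hc := hS.subset hη
    refine ⟨hc, ?_⟩
    obtain ⟨D, -, hD⟩ := exists_isDiag e η (η 0) fun n => by
      rw [abs_of_nonneg (hc.1 n)]
      exact hc.2.1 (Nat.zero_le n)
    exact ⟨D, TwoSidedIdeal.subset_span ⟨η, hη, hD⟩, hD⟩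

theorem isCompactOperator_of_mem_idealOf (e : HilbertBasis ℕ ℂ H) {S : Set (ℕ → ℝ)}
    (hS : IsCharSet S) {X : H →L[ℂ] H} (hX : X ∈ idealOf e S) : IsCompactOperator X := by
  obtain ⟨ξ, hξ, h⟩ := mem_approxIdeal.mp (idealOf_le_approxIdeal e hS hX)
  exact isCompactOperator_of_approx (hS.subset hξ).2.2 h

/-! ### Arithmetic mean closure -/

theorem arithMean_add (ξ η : ℕ → ℝ) : arithMean (ξ + η) = arithMean ξ + arithMean η := by
  ext n
  simp only [arithMean, Pi.add_apply, Finset.sum_add_distrib, add_div]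

theorem arithMean_const_mul (M : ℝ) (ξ : ℕ → ℝ) (n : ℕ) :
    arithMean (fun k => M * ξ k) n = M * arithMean ξ n := by
  simp only [arithMean, ← Finset.mul_sum, mul_div_assoc]

theorem arithMean_mono {ξ η : ℕ → ℝ} (h : ∀ n, ξ n ≤ η n) (n : ℕ) :
    arithMean ξ n ≤ arithMean η n :=
  div_le_div_of_nonneg_right (Finset.sum_le_sum fun i _ => h i) (by positivity)

theorem arithMean_half_le {ξ : ℕ → ℝ} (h : ∀ n, 0 ≤ ξ n) (n : ℕ) :
    arithMean ξ (n / 2) ≤ 2 * arithMean ξ n := by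
  have h1 : ∑ j ∈ Finset.range (n / 2 + 1), ξ j ≤ ∑ j ∈ Finset.range (n + 1), ξ j :=
    Finset.sum_le_sum_of_subset_of_nonneg (Finset.range_subset_range.mpr (by omega))
      fun i _ _ => h i
  have h2 : (n : ℝ) + 1 ≤ 2 * (((n / 2 : ℕ) : ℝ) + 1) := by
    have : n + 1 ≤ 2 * (n / 2 + 1) := by omega
    exact_mod_cast this
  have h0 : 0 ≤ ∑ j ∈ Finset.range (n + 1), ξ j := Finset.sum_nonneg fun i _ => h i
  rw [arithMean, arithMean, mul_div_assoc', div_le_div_iff₀ (by positivity) (by positivity)]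
  nlinarith

/-- Each entry is counted at most twice; the proof even gives `2`, but only some constant is needed.
-/
theorem arithMean_ampl_le {ξ : ℕ → ℝ} (h : ∀ n, 0 ≤ ξ n) (n : ℕ) :
    arithMean (fun k => ξ (k / 2)) n ≤ 4 * arithMean ξ n := by
  have h1 : ∀ m : ℕ, ∑ j ∈ Finset.range (2 * m), ξ (j / 2) = 2 * ∑ j ∈ Finset.range m, ξ j := by
    intro m
    induction m with
    | zero => simp
    | succ m ih =>
      rw [show 2 * (m + 1) = 2 * m + 1 + 1 by ring, Finset.sum_range_succ, Finset.sum_range_succ,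
        ih, Finset.sum_range_succ, show (2 * m + 1) / 2 = m by omega, show 2 * m / 2 = m by omega]
      ring
  have h2 : ∑ j ∈ Finset.range (n + 1), ξ (j / 2) ≤ 2 * ∑ j ∈ Finset.range (n + 1), ξ j := by
    rw [← h1]
    exact Finset.sum_le_sum_of_subset_of_nonneg (Finset.range_subset_range.mpr (by omega))
      fun i _ _ => h _
  have h0 : 0 ≤ ∑ j ∈ Finset.range (n + 1), ξ j := Finset.sum_nonneg fun i _ => h i
  rw [arithMean, arithMean, mul_div_assoc']
  exact div_le_div_of_nonneg_right (by linarith) (by positivity)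

theorem IsCharSet.arithMean {S : Set (ℕ → ℝ)} (hS : IsCharSet S) :
    IsCharSet {ξ | ξ ∈ c0Star ∧ ∃ η ∈ S, ∃ M : ℝ, 0 < M ∧ ∀ n, ξ n ≤ M * arithMean η n} where
  subset := fun _ h => h.1
  zero := ⟨zero_mem_c0Star, 0, hS.zero, 1, one_pos, fun n => by simp [AMIdeal.arithMean]⟩
  mono := by
    rintro ξ ζ ⟨hξ, η, hη, M, hM, h⟩ hζ K hK
    refine ⟨hζ, η, hη, max K 1 * M, by positivity, fun n => ?_⟩
    calc ζ n ≤ K * ξ n := hK n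
      _ ≤ max K 1 * ξ n := mul_le_mul_of_nonneg_right (le_max_left _ _) (hξ.1 n)
      _ ≤ max K 1 * (M * AMIdeal.arithMean η n) := by
          have := h n
          gcongr
      _ = _ := by ring
  add := by
    rintro ξ ζ ⟨hξ, η, hη, M, hM, h⟩ ⟨hζ, θ, hθ, K, hK, h'⟩
    refine ⟨add_mem_c0Star hξ hζ, η + θ, hS.add hη hθ, M + K, by positivity, fun n => ?_⟩
    rw [arithMean_add, Pi.add_apply, Pi.add_apply]
    have h1 := arithMean_nonneg (hS.subset hη).1 n
    have h2 := arithMean_nonneg (hS.subset hθ).1 n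
    nlinarith [h n, h' n]
  ampl := by
    rintro ξ ⟨hξ, η, hη, M, hM, h⟩
    refine ⟨ampl_mem_c0Star hξ, η, hη, M * 2, by positivity, fun n => ?_⟩
    refine (h (n / 2)).trans ?_
    rw [mul_assoc]
    have := arithMean_half_le (hS.subset hη).1 n
    gcongr

theorem IsCharSet.preArithMean {S : Set (ℕ → ℝ)} (hS : IsCharSet S) :
    IsCharSet {ξ | ξ ∈ c0Star ∧ AMIdeal.arithMean ξ ∈ S} where
  subset := fun _ h => h.1
  zero := by
    refine ⟨zero_mem_c0Star, ?_⟩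
    convert hS.zero using 1
    ext n
    simp [AMIdeal.arithMean]
  mono := by
    rintro ξ ζ ⟨hξ, h⟩ hζ K hK
    refine ⟨hζ, hS.mono h (arithMean_mem_c0Star hζ) K fun n => ?_⟩
    rw [← arithMean_const_mul]
    exact arithMean_mono hK n
  add := by
    rintro ξ ζ ⟨hξ, h⟩ ⟨hζ, h'⟩
    refine ⟨add_mem_c0Star hξ hζ, ?_⟩
    rw [arithMean_add]
    exact hS.add h h'
  ampl := by
    rintro ξ ⟨hξ, h⟩
    exact ⟨ampl_mem_c0Star hξ, hS.mono h (arithMean_mem_c0Star (ampl_mem_c0Star hξ)) 4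
      (arithMean_ampl_le hξ.1)⟩

theorem mem_charSet_amClosure_iff (e : HilbertBasis ℕ ℂ H) {I : TwoSidedIdeal (H →L[ℂ] H)}
    {ξ : ℕ → ℝ} : ξ ∈ charSet (amClosure e I) ↔ ξ ∈ c0Star ∧ ∃ η ∈ charSet I, ∃ M : ℝ, 0 < M ∧
      ∀ n, arithMean ξ n ≤ M * arithMean η n := by
  have h1 := isCharSet_charSet e (arithMeanIdeal e I)
  have h2 := (isCharSet_charSet e I).arithMean
  rw [amClosure, preArithMeanIdeal, charSet_idealOf e h1.preArithMean, arithMeanIdeal,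
    charSet_idealOf e h2]
  constructor
  · rintro ⟨hξ, -, h⟩
    exact ⟨hξ, h⟩
  · rintro ⟨hξ, h⟩
    exact ⟨hξ, arithMean_mem_c0Star hξ, h⟩

/-- A proper ideal is am-closed if and only if its characteristic set is hereditary under
submajorization. -/
theorem isAmClosed_iff (e : HilbertBasis ℕ ℂ H) {I : TwoSidedIdeal (H →L[ℂ] H)} (hI : I ≠ ⊤) :
    IsAmClosed e I ↔ ∀ ξ ∈ c0Star, ∀ η ∈ charSet I, (∀ n, arithMean ξ n ≤ arithMean η n) →
      ξ ∈ charSet I := by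
  have hIc : ∀ X ∈ I, IsCompactOperator X := fun X hX => by
    by_contra h
    exact hI (eq_top_of_not_isCompactOperator e hX h)
  have hS := isCharSet_charSet e I
  constructor
  · intro h ξ hξ η hη hle
    rw [h, mem_charSet_amClosure_iff]
    exact ⟨hξ, η, hη, 1, one_pos, by simpa using hle⟩
  · intro h
    refine eq_of_charSet_eq e hIc (fun X hX => isCompactOperator_of_mem_idealOf e
      (isCharSet_charSet e (arithMeanIdeal e I)).preArithMean hX) ?_
    ext ξ
    rw [mem_charSet_amClosure_iff]
    constructor
    · intro hξ
      exact ⟨hS.subset hξ, ξ, hξ, 1, one_pos, fun n => by simp⟩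
    · rintro ⟨hξ, η, hη, M, hM, hle⟩
      -- The constant is absorbed by replacing `η` with `M η`.
      refine h ξ hξ _ (hS.const_mul hη hM.le) fun n => ?_
      rw [arithMean_const_mul]
      exact hle n

end Operators

/-! ### A finite Schur-Horn type theorem -/

section Horn

variable {V : Type*} [AddCommGroup V] [Module ℝ V]

/-- The orthonormal system obtained from `v` by rotating the vectors `v k`, `v (k + 1)` and removing
the first one of the two rotated vectors. -/
def rotateRemove (v : ℕ → V) (k : ℕ) (c s : ℝ) (j : ℕ) : V :=
  if j < k then v j else if j = k then -s • v k + c • v (k + 1) else v (j + 1)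

/-- The diagonal entries of a form in the system `rotateRemove`. -/
def rotateRemoveDiag (q : ℕ → ℝ) (k : ℕ) (c s : ℝ) (j : ℕ) : ℝ :=
  if j < k then q j else if j = k then s ^ 2 * q k + c ^ 2 * q (k + 1) else q (j + 1)

/-- The rotation can create off-diagonal terms only between the two rotated vectors, and one of them
has been removed. Applied to both `G` and `B`. -/
theorem rotateRemove_form {Φ : LinearMap.BilinForm ℝ V} {v : ℕ → V} {q : ℕ → ℝ} {d k : ℕ}
    (hk : k < d) (hΦ : ∀ i j, i < d + 1 → j < d + 1 → Φ (v i) (v j) = if i = j then q i else 0)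
    (c s : ℝ) {i j : ℕ} (hi : i < d) (hj : j < d) :
    Φ (rotateRemove v k c s i) (rotateRemove v k c s j) =
      if i = j then rotateRemoveDiag q k c s i else 0 := by
  have h0 := hΦ k k (by omega) (by omega)
  have h1 := hΦ k (k + 1) (by omega) (by omega)
  have h2 := hΦ (k + 1) k (by omega) (by omega)
  have h3 := hΦ (k + 1) (k + 1) (by omega) (by omega)
  rw [if_pos rfl] at h0 h3
  rw [if_neg (by omega)] at h1 h2
  unfold rotateRemove rotateRemoveDiag
  rcases lt_trichotomy i k with hik | hik | hik <;> rcases lt_trichotomy j k with hjk | hjk | hjk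
  · simp only [hik, hjk, if_true]
    exact hΦ i j (by omega) (by omega)
  · subst hjk
    simp only [hik, lt_irrefl, if_true, if_false, map_add, map_smul, smul_eq_mul,
      hΦ i j (by omega) (by omega), hΦ i (j + 1) (by omega) (by omega), hik.ne,
      show i ≠ j + 1 by omega]
    simp
  · simp only [hik, if_true, hjk.not_gt, hjk.ne', if_false, hΦ i (j + 1) (by omega) (by omega),
      show i ≠ j + 1 by omega, show i ≠ j by omega]
  · subst hik
    simp only [hjk, lt_irrefl, if_true, if_false, map_add, map_smul, smul_eq_mul,
      LinearMap.add_apply, LinearMap.smul_apply,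
      hΦ i j (by omega) (by omega), hΦ (i + 1) j (by omega) (by omega), hjk.ne',
      show i + 1 ≠ j by omega]
    simp
  · subst hik
    subst hjk
    simp only [lt_irrefl, if_true, if_false, map_add, map_smul, smul_eq_mul,
      LinearMap.add_apply, LinearMap.smul_apply, h0, h1, h2, h3]
    ring
  · subst hik
    simp only [hjk.not_gt, hjk.ne', lt_irrefl, if_true, if_false, map_add, map_smul, smul_eq_mul,
      LinearMap.add_apply, LinearMap.smul_apply,
      hΦ i (j + 1) (by omega) (by omega), hΦ (i + 1) (j + 1) (by omega) (by omega),
      show i ≠ j + 1 by omega, show i + 1 ≠ j + 1 by omega, show i ≠ j by omega]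
    simp
  · simp only [hik.not_gt, hik.ne', hjk, if_true, if_false, hΦ (i + 1) j (by omega) (by omega),
      show i + 1 ≠ j by omega, show i ≠ j by omega]
  · subst hjk
    simp only [hik.not_gt, hik.ne', lt_irrefl, if_true, if_false, map_add, map_smul, smul_eq_mul,
      hΦ (i + 1) j (by omega) (by omega), hΦ (i + 1) (j + 1) (by omega) (by omega),
      show i + 1 ≠ j by omega, show i + 1 ≠ j + 1 by omega]
    simp
  · simp only [hik.not_gt, hik.ne', hjk.not_gt, hjk.ne', if_false,
      hΦ (i + 1) (j + 1) (by omega) (by omega), add_left_inj]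

theorem rotated_form_rotateRemove {G : LinearMap.BilinForm ℝ V} {v : ℕ → V} {d k : ℕ}
    (hk : k < d) (hG : ∀ i j, i < d + 1 → j < d + 1 → G (v i) (v j) = if i = j then (1 : ℝ) else 0)
    (c s : ℝ) {j : ℕ} (hj : j < d) :
    G (c • v k + s • v (k + 1)) (rotateRemove v k c s j) = 0 ∧
      G (rotateRemove v k c s j) (c • v k + s • v (k + 1)) = 0 := by
  have h0 := hG k k (by omega) (by omega)
  have h1 := hG k (k + 1) (by omega) (by omega)
  have h2 := hG (k + 1) k (by omega) (by omega)
  have h3 := hG (k + 1) (k + 1) (by omega) (by omega)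
  rw [if_pos rfl] at h0 h3
  rw [if_neg (by omega)] at h1 h2
  unfold rotateRemove
  rcases lt_trichotomy j k with hjk | hjk | hjk
  · simp only [hjk, if_true, map_add, map_smul, smul_eq_mul, LinearMap.add_apply,
      LinearMap.smul_apply, hG j k (by omega) (by omega), hG k j (by omega) (by omega),
      hG j (k + 1) (by omega) (by omega), hG (k + 1) j (by omega) (by omega), hjk.ne, hjk.ne',
      show j ≠ k + 1 by omega, show k + 1 ≠ j by omega]
    simp
  · simp only [hjk, lt_irrefl, if_true, if_false, map_add, map_smul, smul_eq_mul,
      LinearMap.add_apply, LinearMap.smul_apply, h0, h1, h2, h3]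
    constructor <;> ring
  · simp only [hjk.not_gt, hjk.ne', if_false, map_add, map_smul, smul_eq_mul,
      LinearMap.add_apply, LinearMap.smul_apply, hG (j + 1) k (by omega) (by omega),
      hG k (j + 1) (by omega) (by omega), hG (j + 1) (k + 1) (by omega) (by omega),
      hG (k + 1) (j + 1) (by omega) (by omega), show j + 1 ≠ k by omega, show k ≠ j + 1 by omega,
      show j + 1 ≠ k + 1 by omega, show k + 1 ≠ j + 1 by omega]
    simp

/-- The rotation preserves `y k + y (k + 1)`, so removing the value `t` lowers later partial sums by
exactly `t`. -/
theorem sum_rotateRemoveDiag {y : ℕ → ℝ} {k : ℕ} {c s t : ℝ}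
    (ht : s ^ 2 * y k + c ^ 2 * y (k + 1) = y k + y (k + 1) - t) (m : ℕ) :
    ∑ j ∈ Finset.range m, rotateRemoveDiag y k c s j =
      if m ≤ k then ∑ j ∈ Finset.range m, y j else ∑ j ∈ Finset.range (m + 1), y j - t := by
  induction m with
  | zero => simp
  | succ m ih =>
    rw [Finset.sum_range_succ, ih, rotateRemoveDiag]
    rcases lt_trichotomy m k with h | rfl | h
    · rw [if_pos h.le, if_pos h, if_pos (by omega), Finset.sum_range_succ]
    · rw [if_pos le_rfl, if_neg (lt_irrefl _), if_pos rfl, if_neg (by omega), ht,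
        Finset.sum_range_succ _ (m + 1), Finset.sum_range_succ]
      ring
    · rw [if_neg (by omega), if_neg (by omega), if_neg (by omega), if_neg (by omega),
        Finset.sum_range_succ _ (m + 1)]
      ring

/-- The new entry is a convex combination of `y k` and `y (k + 1)`, which it replaces. -/
theorem antitone_rotateRemoveDiag {y : ℕ → ℝ} (hy : Antitone y) {k : ℕ} {c s : ℝ}
    (hcs : c ^ 2 + s ^ 2 = 1) : Antitone (rotateRemoveDiag y k c s) := by
  have h : y (k + 1) ≤ y k := hy (Nat.le_succ k)
  have hs2 : s ^ 2 = 1 - c ^ 2 := by linarith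
  refine antitone_nat_of_succ_le fun j => ?_
  unfold rotateRemoveDiag
  have hc := sq_nonneg c
  have hs := sq_nonneg s
  rcases lt_trichotomy (j + 1) k with hj | hj | hj
  · rw [if_pos hj, if_pos (by omega)]
    exact hy (Nat.le_succ j)
  · rw [if_neg (by omega), if_pos hj, if_pos (by omega)]
    have h2 : y k ≤ y j := hy (by omega)
    have : s ^ 2 * y k + c ^ 2 * y (k + 1) ≤ y k := by
      rw [hs2]
      nlinarith [mul_nonneg hc (sub_nonneg.mpr h)]
    exact this.trans h2
  · rw [if_neg (by omega), if_neg (by omega), if_neg (show ¬ j < k by omega)]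
    split_ifs with hjk
    · subst hjk
      have h2 : y (j + 1 + 1) ≤ y (j + 1) := hy (Nat.le_succ _)
      have : y (j + 1) ≤ s ^ 2 * y j + c ^ 2 * y (j + 1) := by
        rw [hs2] at hs ⊢
        nlinarith [mul_nonneg hs (sub_nonneg.mpr h)]
      exact h2.trans this
    · exact hy (Nat.le_succ _)

/-- If `x` is submajorized by `y` and `y` is the list of diagonal entries of a form `B` that is
diagonal in a `G`-orthonormal system, then another `G`-orthonormal system in the same span has
diagonal entries dominating `x`. -/
theorem exists_orthonormal_diag_ge (G B : LinearMap.BilinForm ℝ V) (d : ℕ) :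
    ∀ (x y : ℕ → ℝ) (v : ℕ → V), Antitone x → Antitone y →
      (∀ m ≤ d, ∑ j ∈ Finset.range m, x j ≤ ∑ j ∈ Finset.range m, y j) →
      (∀ i j, i < d → j < d → G (v i) (v j) = if i = j then 1 else 0) →
      (∀ i j, i < d → j < d → B (v i) (v j) = if i = j then y i else 0) →
      ∃ u : ℕ → V, (∀ i < d, u i ∈ Submodule.span ℝ (v '' Set.Iio d)) ∧
        (∀ i j, i < d → j < d → G (u i) (u j) = if i = j then 1 else 0) ∧
        ∀ i < d, x i ≤ B (u i) (u i) := by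
  induction d with
  | zero =>
    intro x y v _ _ _ _ _
    exact ⟨v, by simp, by simp, by simp⟩
  | succ d ih =>
    intro x y v hx hy hle hG hB
    by_cases hall : ∀ i < d + 1, x 0 ≤ y i
    · refine ⟨v, fun i hi => Submodule.subset_span ⟨i, hi, rfl⟩, hG, fun i hi => ?_⟩
      rw [hB i i hi hi, if_pos rfl]
      exact (hx (Nat.zero_le i)).trans (hall i hi)
    push Not at hall
    -- Where `y` first drops below `x 0`. This is not at index `0`, since `x 0 ≤ y 0`.
    obtain ⟨K, ⟨hKd, hKy⟩, hKmin⟩ : ∃ K, (K < d + 1 ∧ y K < x 0) ∧ ∀ i < K, x 0 ≤ y i := by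
      classical
      refine ⟨Nat.find hall, Nat.find_spec hall, fun i hi => ?_⟩
      have := Nat.find_min hall hi
      push Not at this
      exact this (hi.trans (Nat.find_spec hall).1)
    obtain ⟨k, rfl⟩ : ∃ k, K = k + 1 := by
      refine Nat.exists_eq_succ_of_ne_zero ?_
      rintro rfl
      have := hle 1 (by omega)
      simp at this
      linarith
    have hyk : x 0 ≤ y k := hKmin k (Nat.lt_succ_self k)
    have hgap : 0 < y k - y (k + 1) := by linarith
    -- `c ^ 2` and `s ^ 2` are the weights expressing `x 0` as a convex combination of `y k` and `y
    -- (k + 1)`, so the removed vector has `B`-value exactly `x 0`.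
    set c := √((x 0 - y (k + 1)) / (y k - y (k + 1))) with hc
    set s := √((y k - x 0) / (y k - y (k + 1))) with hs
    have hc2 : c ^ 2 = (x 0 - y (k + 1)) / (y k - y (k + 1)) :=
      Real.sq_sqrt (div_nonneg (by linarith) hgap.le)
    have hs2 : s ^ 2 = (y k - x 0) / (y k - y (k + 1)) :=
      Real.sq_sqrt (div_nonneg (by linarith) hgap.le)
    have hcs : c ^ 2 + s ^ 2 = 1 := by
      rw [hc2, hs2]
      field_simp
      ring
    have hw : c ^ 2 * y k + s ^ 2 * y (k + 1) = x 0 := by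
      rw [hc2, hs2]
      field_simp
      ring
    have hz : s ^ 2 * y k + c ^ 2 * y (k + 1) = y k + y (k + 1) - x 0 := by
      have h1 : s ^ 2 = 1 - c ^ 2 := by linarith
      rw [h1] at hw ⊢
      linarith
    have hk : k < d := by omega
    have hG' : ∀ i j, i < d → j < d →
        G (rotateRemove v k c s i) (rotateRemove v k c s j) = if i = j then 1 else 0 := by
      intro i j hi hj
      rw [rotateRemove_form (q := fun _ => 1) hk hG c s hi hj]
      simp only [rotateRemoveDiag, mul_one]
      rw [show s ^ 2 + c ^ 2 = 1 by linarith]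
      simp
    -- Submajorization survives: up to `k` every `y j` is at least `x 0`, and beyond it both sides
    -- have lost `x 0`.
    obtain ⟨u, hu, huG, hux⟩ := ih (fun j => x (j + 1)) (rotateRemoveDiag y k c s)
      (rotateRemove v k c s) (fun a b h => hx (by omega)) (antitone_rotateRemoveDiag hy hcs) (by
        intro m hm
        rw [sum_rotateRemoveDiag hz]
        split_ifs with hmk
        · refine Finset.sum_le_sum fun j hj => ?_
          have : j < m := Finset.mem_range.mp hj
          exact (hx (Nat.zero_le _)).trans (hKmin j (by omega))
        · have := hle (m + 1) (by omega)
          rw [Finset.sum_range_succ'] at this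
          linarith) hG' (fun i j hi hj => rotateRemove_form hk hB c s hi hj)
    have horth : ∀ p ∈ Submodule.span ℝ (rotateRemove v k c s '' Set.Iio d),
        G (c • v k + s • v (k + 1)) p = 0 ∧ G p (c • v k + s • v (k + 1)) = 0 := by
      have hj := fun j => rotated_form_rotateRemove (j := j) hk hG c s
      revert hj
      generalize c • v k + s • v (k + 1) = w
      intro hw p hp
      induction hp using Submodule.span_induction with
      | mem p hp =>
        obtain ⟨j, hj, rfl⟩ := hp
        exact hw j hj
      | zero => simp
      | add p q _ _ hp hq => simp [hp.1, hp.2, hq.1, hq.2]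
      | smul a p _ hp => simp [hp.1, hp.2]
    have hmem : ∀ i < d + 1, v i ∈ Submodule.span ℝ (v '' Set.Iio (d + 1)) := fun i hi =>
      Submodule.subset_span ⟨i, hi, rfl⟩
    have hwG : G (c • v k + s • v (k + 1)) (c • v k + s • v (k + 1)) = 1 := by
      simp only [map_add, map_smul, smul_eq_mul, LinearMap.add_apply, LinearMap.smul_apply,
        hG k k (by omega) (by omega), hG k (k + 1) (by omega) (by omega),
        hG (k + 1) k (by omega) (by omega), hG (k + 1) (k + 1) (by omega) (by omega)]
      simp
      linarith
    have hwB : B (c • v k + s • v (k + 1)) (c • v k + s • v (k + 1)) = x 0 := by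
      simp only [map_add, map_smul, smul_eq_mul, LinearMap.add_apply, LinearMap.smul_apply,
        hB k k (by omega) (by omega), hB k (k + 1) (by omega) (by omega),
        hB (k + 1) k (by omega) (by omega), hB (k + 1) (k + 1) (by omega) (by omega)]
      simp
      linarith
    refine ⟨fun i => Nat.casesOn i (c • v k + s • v (k + 1)) u, ?_, ?_, ?_⟩
    · intro i hi
      cases i with
      | zero =>
        exact Submodule.add_mem _ (Submodule.smul_mem _ _ (hmem _ (by omega)))
          (Submodule.smul_mem _ _ (hmem _ (by omega)))
      | succ i =>
        refine Submodule.span_le.mpr ?_ (hu i (by omega))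
        rintro _ ⟨j, hj, rfl⟩
        have hj' : j < d := hj
        unfold rotateRemove
        split_ifs
        · exact hmem _ (by omega)
        · exact Submodule.add_mem _ (Submodule.smul_mem _ _ (hmem _ (by omega)))
            (Submodule.smul_mem _ _ (hmem _ (by omega)))
        · exact hmem _ (by omega)
    · intro i j hi hj
      cases i with
      | zero =>
        cases j with
        | zero => simpa using hwG
        | succ j => simpa using (horth _ (hu j (by omega))).1
      | succ i =>
        cases j with
        | zero => simpa using (horth _ (hu i (by omega))).2
        | succ j => simpa using huG i j (by omega) (by omega)
    · intro i hi
      cases i with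
      | zero => exact hwB.ge
      | succ i => exact hux i (by omega)

/-- The bilinear form `∑ j < d, y j * p j * q j`. -/
def diagForm (d : ℕ) (y : ℕ → ℝ) : LinearMap.BilinForm ℝ (ℕ → ℝ) :=
  LinearMap.mk₂ ℝ (fun p q => ∑ j ∈ Finset.range d, y j * p j * q j)
    (fun p p' q => by simp only [Pi.add_apply, mul_add, add_mul, Finset.sum_add_distrib])
    (fun c p q => by
      simp only [Pi.smul_apply, smul_eq_mul, Finset.mul_sum]
      exact Finset.sum_congr rfl fun _ _ => by ring)
    (fun p q q' => by simp only [Pi.add_apply, mul_add, Finset.sum_add_distrib])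
    (fun c p q => by
      simp only [Pi.smul_apply, smul_eq_mul, Finset.mul_sum]
      exact Finset.sum_congr rfl fun _ _ => by ring)

theorem diagForm_apply (d : ℕ) (y p q : ℕ → ℝ) :
    diagForm d y p q = ∑ j ∈ Finset.range d, y j * p j * q j := rfl

theorem diagForm_single {d : ℕ} (y : ℕ → ℝ) {i j : ℕ} (hi : i < d) :
    diagForm d y (Pi.single i 1) (Pi.single j 1) = if i = j then y i else 0 := by
  rw [diagForm_apply, Finset.sum_eq_single i]
  · by_cases h : i = j <;> simp [h]
  · intro m _ hm
    simp [hm]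
  · intro h
    exact absurd (Finset.mem_range.mpr hi) h

/-- A weak form of Horn's theorem: if the nonincreasing list `x` is submajorized by the
nonincreasing list `y`, then some orthostochastic image of `y` dominates `x`. -/
theorem exists_orthogonal_ge {x y : ℕ → ℝ} (hx : Antitone x) (hy : Antitone y) (d : ℕ)
    (h : ∀ m ≤ d, ∑ j ∈ Finset.range m, x j ≤ ∑ j ∈ Finset.range m, y j) :
    ∃ l : ℕ → ℕ → ℝ,
      (∀ i j, i < d → j < d → ∑ a ∈ Finset.range d, l i a * l j a = if i = j then 1 else 0) ∧
      ∀ i < d, x i ≤ ∑ a ∈ Finset.range d, l i a ^ 2 * y a := by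
  obtain ⟨u, -, hG, hB⟩ := exists_orthonormal_diag_ge (diagForm d fun _ => 1) (diagForm d y) d x y
    (fun i => Pi.single i 1) hx hy h (fun i j hi _ => diagForm_single (fun _ => 1) hi)
    (fun i j hi _ => diagForm_single y hi)
  refine ⟨u, fun i j hi hj => ?_, fun i hi => ?_⟩
  · simpa only [diagForm_apply, one_mul] using hG i j hi hj
  · refine (hB i hi).trans (le_of_eq ?_)
    rw [diagForm_apply]
    exact Finset.sum_congr rfl fun _ _ => by ring

end Horn

/-! ### Direct sums of finite matrices -/

theorem exists_block {n : ℕ → ℕ} (h0 : n 0 = 0) (hn : StrictMono n) (i : ℕ) :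
    ∃ k, n k ≤ i ∧ i < n (k + 1) := by
  induction i with
  | zero => exact ⟨0, h0.le, by
    have := hn (Nat.lt_add_one 0)
    omega⟩
  | succ i ih =>
    obtain ⟨k, h1, h2⟩ := ih
    by_cases h : i + 1 < n (k + 1)
    · exact ⟨k, by omega, h⟩
    · exact ⟨k + 1, by omega, by have := hn (Nat.lt_add_one (k + 1)); omega⟩

theorem block_unique {n : ℕ → ℕ} (hn : StrictMono n) {i k l : ℕ} (hk : n k ≤ i ∧ i < n (k + 1))
    (hl : n l ≤ i ∧ i < n (l + 1)) : k = l := by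
  rcases lt_trichotomy k l with h | h | h
  · have := hn.monotone (Nat.succ_le_of_lt h)
    simp only [Nat.succ_eq_add_one] at this
    omega
  · exact h
  · have := hn.monotone (Nat.succ_le_of_lt h)
    simp only [Nat.succ_eq_add_one] at this
    omega

theorem IsDirectSum.transpose {R : Type*} [Zero R] {C : (d : ℕ) → Set (Matrix (Fin d) (Fin d) R)}
    (hC : ∀ d, ∀ A ∈ C d, A.transpose ∈ C d) {M : Matrix ℕ ℕ R} (h : IsDirectSum C M) :
    IsDirectSum C M.transpose := by
  obtain ⟨n, h0, hn, hz, hb⟩ := h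
  refine ⟨n, h0, hn, fun i j hij => hz j i fun ⟨k, h1, h2⟩ => hij ⟨k, h2, h1⟩, fun k => ?_⟩
  exact hC _ _ (hb k)

theorem transpose_mem_orthogonalGroup {d : ℕ} {A : Matrix (Fin d) (Fin d) ℝ}
    (hA : A ∈ Matrix.orthogonalGroup (Fin d) ℝ) :
    A.transpose ∈ Matrix.orthogonalGroup (Fin d) ℝ := by
  rw [Matrix.mem_orthogonalGroup_iff'] at hA
  rw [Matrix.mem_orthogonalGroup_iff]
  simpa using hA

theorem sq_mem_doublyStochastic {d : ℕ} {A : Matrix (Fin d) (Fin d) ℝ}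
    (hA : A ∈ Matrix.orthogonalGroup (Fin d) ℝ) :
    (Matrix.of fun a b => A a b ^ 2) ∈ doublyStochastic ℝ (Fin d) := by
  have h1 := (Matrix.mem_orthogonalGroup_iff _ _).mp hA
  have h2 := (Matrix.mem_orthogonalGroup_iff' _ _).mp hA
  rw [mem_doublyStochastic_iff_sum]
  refine ⟨fun i j => sq_nonneg _, fun i => ?_, fun j => ?_⟩
  · have := congrFun (congrFun h1 i) i
    simpa [Matrix.mul_apply, Matrix.star_apply, sq] using this
  · have := congrFun (congrFun h2 j) j
    simpa [Matrix.mul_apply, Matrix.star_apply, sq] using this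

theorem blockOrthostochastic_subset : blockOrthostochastic ⊆ blockStochastic := by
  rintro Q ⟨L, ⟨n, h0, hn, hz, hb⟩, hQ⟩
  refine ⟨n, h0, hn, fun i j hij => by rw [hQ, hz i j hij]; simp, fun k => ?_⟩
  have := sq_mem_doublyStochastic (hb k)
  simp only [hQ]
  exact this

theorem hasSum_block_row {n : ℕ → ℕ} {M : Matrix ℕ ℕ ℝ} (hn : StrictMono n)
    (hz : ∀ i j, (¬ ∃ k, (n k ≤ i ∧ i < n (k + 1)) ∧ (n k ≤ j ∧ j < n (k + 1))) → M i j = 0)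
    (f : ℕ → ℝ) {i k : ℕ} (hi : n k ≤ i ∧ i < n (k + 1)) :
    HasSum (fun j => M i j * f j)
      (∑ b ∈ Finset.range (n (k + 1) - n k), M i (n k + b) * f (n k + b)) := by
  rw [← Finset.sum_Ico_eq_sum_range (fun j => M i j * f j)]
  refine hasSum_sum_of_ne_finset_zero fun j hj => ?_
  rw [hz i j, zero_mul]
  rintro ⟨l, hl, hlj⟩
  obtain rfl := block_unique hn hi hl
  exact hj (Finset.mem_Ico.mpr hlj)

theorem hasSum_row_of_mem_blockStochastic {P : Matrix ℕ ℕ ℝ} (hP : P ∈ blockStochastic) (i : ℕ) :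
    (∀ j, 0 ≤ P i j) ∧ HasSum (fun j => P i j) 1 := by
  obtain ⟨n, h0, hn, hz, hb⟩ := hP
  obtain ⟨k, hk⟩ := exists_block h0 hn i
  have hds := mem_doublyStochastic_iff_sum.mp (hb k)
  have hi : n k + (i - n k) = i := by omega
  constructor
  · intro j
    by_cases hj : n k ≤ j ∧ j < n (k + 1)
    · have := hds.1 ⟨i - n k, by omega⟩ ⟨j - n k, by omega⟩
      simpa [hi, show n k + (j - n k) = j by omega] using this
    · rw [hz i j]
      rintro ⟨l, hl, hlj⟩
      obtain rfl := block_unique hn hk hl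
      exact hj hlj
  · have h1 := hasSum_block_row hn hz (fun _ => 1) hk
    have h2 := hds.2.1 ⟨i - n k, by omega⟩
    simp only [Matrix.of_apply, hi] at h2
    rw [← h2, ← Finset.sum_range fun b => P i (n k + b)]
    simpa only [mul_one] using h1

theorem blockStochastic_subset : blockStochastic ⊆ doublyStochasticInf := by
  intro P hP
  have hPt : P.transpose ∈ blockStochastic :=
    IsDirectSum.transpose (fun d A hA => transpose_mem_doublyStochastic_iff.mpr hA) hP
  have hr := hasSum_row_of_mem_blockStochastic hP
  have hc := hasSum_row_of_mem_blockStochastic hPt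
  have hs : P ∈ substochastic :=
    ⟨fun i j => (hr i).1 j, fun i => ⟨(hr i).2.summable, (hr i).2.tsum_eq.le⟩,
      fun j => ⟨(hc j).2.summable, (hc j).2.tsum_eq.le⟩⟩
  exact ⟨⟨hs, fun i => (hr i).2⟩, ⟨hs, fun j => (hc j).2⟩⟩

section Operators

variable {H : Type*} [NormedAddCommGroup H] [InnerProductSpace ℂ H] [CompleteSpace H]

/-! ### Schur squares of operators -/

theorem hasSum_norm_inner_sq (e : HilbertBasis ℕ ℂ H) (x : H) :
    HasSum (fun i => ‖inner ℂ (e i) x‖ ^ 2) (‖x‖ ^ 2) := by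
  have h := e.hasSum_inner_mul_inner x x
  rw [inner_self_eq_norm_sq_to_K] at h
  have h2 : HasSum (fun i => ((‖inner ℂ (e i) x‖ ^ 2 : ℝ) : ℂ)) ((‖x‖ ^ 2 : ℝ) : ℂ) := by
    have h3 : (fun i => ((‖inner ℂ (e i) x‖ ^ 2 : ℝ) : ℂ)) =
        fun i => inner ℂ x (e i) * inner ℂ (e i) x := by
      funext i
      rw [← inner_conj_symm x (e i), Complex.conj_mul']
      push_cast
      rfl
    rw [h3, Complex.ofReal_pow]
    exact h
  exact_mod_cast h2

theorem hasSum_entry_col (e : HilbertBasis ℕ ℂ H) (L : H →L[ℂ] H) (j : ℕ) :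
    HasSum (fun i => ‖entry e L i j‖ ^ 2) (‖L (e j)‖ ^ 2) :=
  hasSum_norm_inner_sq e (L (e j))

theorem entry_star (e : HilbertBasis ℕ ℂ H) (L : H →L[ℂ] H) (i j : ℕ) :
    ‖entry e (star L) i j‖ = ‖entry e L j i‖ := by
  rw [entry, entry, ContinuousLinearMap.star_eq_adjoint, ContinuousLinearMap.adjoint_inner_right,
    ← inner_conj_symm, RCLike.norm_conj]

theorem hasSum_entry_row (e : HilbertBasis ℕ ℂ H) (L : H →L[ℂ] H) (i : ℕ) :
    HasSum (fun j => ‖entry e L i j‖ ^ 2) (‖star L (e i)‖ ^ 2) := by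
  simpa only [entry_star] using hasSum_entry_col e (star L) i

theorem norm_apply_of_star_mul_self {L : H →L[ℂ] H} (hL : star L * L = 1) (x : H) :
    ‖L x‖ = ‖x‖ := by
  have h := inner_apply_apply L x x
  rw [hL, one_apply_eq_self, inner_self_eq_norm_sq_to_K, inner_self_eq_norm_sq_to_K] at h
  have h2 : ‖L x‖ ^ 2 = ‖x‖ ^ 2 := by
    apply Complex.ofReal_injective
    simpa using h
  exact (sq_eq_sq₀ (norm_nonneg _) (norm_nonneg _)).mp h2

theorem norm_le_one_of_star_mul_self {L : H →L[ℂ] H} (hL : star L * L = 1) : ‖L‖ ≤ 1 :=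
  L.opNorm_le_bound zero_le_one fun x => by rw [norm_apply_of_star_mul_self hL, one_mul]

theorem mem_substochastic_of_norm_le_one (e : HilbertBasis ℕ ℂ H) {L : H →L[ℂ] H} (hL : ‖L‖ ≤ 1)
    {Q : Matrix ℕ ℕ ℝ} (hQ : ∀ i j, Q i j = ‖entry e L i j‖ ^ 2) : Q ∈ substochastic := by
  have hle : ∀ (T : H →L[ℂ] H), ‖T‖ ≤ 1 → ∀ i, ‖T (e i)‖ ^ 2 ≤ 1 := fun T hT i => by
    have := T.le_of_opNorm_le hT (e i)
    rw [norm_basis, mul_one] at this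
    exact pow_le_one₀ (norm_nonneg _) this
  refine ⟨fun i j => by rw [hQ]; positivity, fun i => ?_, fun j => ?_⟩
  · simp only [hQ]
    have h := hasSum_entry_row e L i
    exact ⟨h.summable, h.tsum_eq ▸ hle _ (by rwa [norm_star]) i⟩
  · simp only [hQ]
    have h := hasSum_entry_col e L j
    exact ⟨h.summable, h.tsum_eq ▸ hle _ hL j⟩

theorem isometryStochastic_subset (e : HilbertBasis ℕ ℂ H) :
    isometryStochastic e ⊆ substochastic := by
  rintro Q ⟨L, hL, hQ⟩
  exact mem_substochastic_of_norm_le_one e (norm_le_one_of_star_mul_self hL) hQ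

theorem coisometryStochastic_subset (e : HilbertBasis ℕ ℂ H) :
    coisometryStochastic e ⊆ substochastic := by
  rintro Q ⟨L, hL, hQ⟩
  refine mem_substochastic_of_norm_le_one e ?_ hQ
  rw [← norm_star]
  exact norm_le_one_of_star_mul_self (by rwa [star_star])

theorem unistochastic_subset_isometryStochastic (e : HilbertBasis ℕ ℂ H) :
    unistochastic e ⊆ isometryStochastic e := by
  rintro Q ⟨U, hU, hQ⟩
  exact ⟨U, (Unitary.mem_iff.mp hU).1, hQ⟩

theorem unistochastic_subset_coisometryStochastic (e : HilbertBasis ℕ ℂ H) :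
    unistochastic e ⊆ coisometryStochastic e := by
  rintro Q ⟨U, hU, hQ⟩
  exact ⟨U, (Unitary.mem_iff.mp hU).2, hQ⟩

theorem unistochastic_subset_doublyStochasticInf (e : HilbertBasis ℕ ℂ H) :
    unistochastic e ⊆ doublyStochasticInf := by
  rintro Q ⟨U, hU, hQ⟩
  obtain ⟨h1, h2⟩ := Unitary.mem_iff.mp hU
  have hs := mem_substochastic_of_norm_le_one e (norm_le_one_of_star_mul_self h1) hQ
  refine ⟨⟨hs, fun i => ?_⟩, ⟨hs, fun j => ?_⟩⟩
  · have h := hasSum_entry_row e U i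
    rw [norm_apply_of_star_mul_self (by rwa [star_star]), norm_basis, one_pow] at h
    simpa only [hQ] using h
  · have h := hasSum_entry_col e U j
    rw [norm_apply_of_star_mul_self h1, norm_basis, one_pow] at h
    simpa only [hQ] using h

theorem orthostochastic_subset_unistochastic (e : HilbertBasis ℕ ℂ H) :
    orthostochastic e ⊆ unistochastic e := by
  rintro Q ⟨U, hU, -, hQ⟩
  exact ⟨U, hU, hQ⟩

/-- Columns have finite support: within a block orthonormality is `Aᵀ A = 1`, and different blocks
have disjoint supports. -/
theorem exists_orthonormal_columns (e : HilbertBasis ℕ ℂ H) {L : Matrix ℕ ℕ ℝ}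
    (hL : IsDirectSum
      (fun d => (Matrix.orthogonalGroup (Fin d) ℝ : Set (Matrix (Fin d) (Fin d) ℝ))) L) :
    ∃ w : ℕ → H, (∀ i j, inner ℂ (e i) (w j) = L i j) ∧
      ∀ i j, inner ℂ (w i) (w j) = if i = j then (1 : ℂ) else 0 := by
  obtain ⟨n, h0, hn, hz, hb⟩ := hL
  choose k hk using exists_block h0 hn
  let w : ℕ → H := fun j => ∑ i ∈ Finset.Ico (n (k j)) (n (k j + 1)), (L i j : ℂ) • e i
  have hw : ∀ i j, inner ℂ (e i) (w j) = L i j := by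
    intro i j
    simp only [w, inner_sum, inner_smul_right, inner_basis, mul_ite, mul_one, mul_zero,
      Finset.sum_ite_eq, Finset.mem_Ico]
    split_ifs with h
    · rfl
    · rw [hz i j, Complex.ofReal_zero]
      rintro ⟨l, hl, hlj⟩
      obtain rfl := block_unique hn (hk j) hlj
      exact h hl
  refine ⟨w, hw, fun i j => ?_⟩
  have hin : inner ℂ (w i) (w j) =
      ((∑ a ∈ Finset.Ico (n (k i)) (n (k i + 1)), L a i * L a j : ℝ) : ℂ) := by
    simp only [w, sum_inner, inner_smul_left]
    push_cast
    refine Finset.sum_congr rfl fun a _ => ?_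
    rw [Complex.conj_ofReal]
    congr 1
    exact hw a j
  rw [hin]
  by_cases hij : k i = k j
  · have h1 := (Matrix.mem_orthogonalGroup_iff' _ _).mp (hb (k i))
    have hi := hk i
    have hj := hk j
    rw [← hij] at hj
    have h2 := congrFun (congrFun h1 ⟨i - n (k i), by omega⟩) ⟨j - n (k i), by omega⟩
    rw [Matrix.mul_apply] at h2
    simp only [Matrix.transpose_apply, Matrix.of_apply, Matrix.one_apply, Fin.mk.injEq,
      show n (k i) + (i - n (k i)) = i by omega, show n (k i) + (j - n (k i)) = j by omega] at h2
    rw [Finset.sum_Ico_eq_sum_range, Finset.sum_range, h2]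
    by_cases h : i = j
    · simp [h]
    · rw [if_neg h, if_neg (by omega)]
      simp
  · have hne : i ≠ j := fun h => hij (by rw [h])
    rw [if_neg hne, Finset.sum_eq_zero, Complex.ofReal_zero]
    intro a ha
    rw [Finset.mem_Ico] at ha
    rw [hz a j, mul_zero]
    rintro ⟨l, hl, hlj⟩
    exact hij ((block_unique hn ha hl).trans (block_unique hn (hk j) hlj).symm)

theorem star_mul_self_eq_one {U : H →L[ℂ] H} (e : HilbertBasis ℕ ℂ H)
    (h : ∀ i j, inner ℂ (U (e i)) (U (e j)) = if i = j then (1 : ℂ) else 0) : star U * U = 1 := by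
  refine clm_ext_basis e fun j => eq_of_inner_basis e fun i => ?_
  rw [← inner_apply_apply, h, one_apply_eq_self, inner_basis]

theorem blockOrthostochastic_subset_orthostochastic (e : HilbertBasis ℕ ℂ H) :
    blockOrthostochastic ⊆ orthostochastic e := by
  rintro Q ⟨L, hL, hQ⟩
  obtain ⟨w, hwL, hw⟩ := exists_orthonormal_columns e hL
  -- The rows of `L` give the adjoint, hence `U U* = 1` as well as `U* U = 1`.
  obtain ⟨w', hwL', hw'⟩ := exists_orthonormal_columns e
    (hL.transpose fun d A hA => transpose_mem_orthogonalGroup hA)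
  obtain ⟨U, -, hU⟩ := exists_clm_basis e w (fun i j hij => by rw [hw, if_neg hij]) 1 (fun n => by
    have := hw n n
    rw [if_pos rfl, inner_self_eq_norm_sq_to_K] at this
    have h2 : ‖w n‖ ^ 2 = 1 := by
      apply Complex.ofReal_injective
      simpa using this
    exact (sq_le_one_iff₀ (norm_nonneg _)).mp h2.le)
  have hent : ∀ i j, entry e U i j = L i j := fun i j => by rw [entry, hU, hwL]
  have hU' : ∀ n, star U (e n) = w' n := fun n => eq_of_inner_basis e fun m => by
    rw [ContinuousLinearMap.star_eq_adjoint, ContinuousLinearMap.adjoint_inner_right, hU, hwL',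
      ← inner_conj_symm, hwL, Complex.conj_ofReal]
    rfl
  refine ⟨U, Unitary.mem_iff.mpr ⟨?_, ?_⟩, fun i j => by rw [hent, Complex.ofReal_im],
    fun i j => by rw [hent, hQ, Complex.norm_real, Real.norm_eq_abs, sq_abs]⟩
  · exact star_mul_self_eq_one e fun i j => by rw [hU, hU, hw]
  · have := star_mul_self_eq_one (U := star U) e fun i j => by rw [hU', hU', hw']
    rwa [star_star] at this

/-! ### Invariance and the trace class -/

theorem InvariantUnder.mono {I : TwoSidedIdeal (H →L[ℂ] H)} {Ps Qs : Set (Matrix ℕ ℕ ℝ)}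
    (h : InvariantUnder I Qs) (hPQ : Ps ⊆ Qs) : InvariantUnder I Ps :=
  fun P hP => h P (hPQ hP)

/-- The Householder reflection exchanging `e 0` with a unit vector having nonnegative
coordinates. -/
theorem exists_orthostochastic_col (e : HilbertBasis ℕ ℂ H) {f : ℕ → ℝ} (hf : ∀ n, 0 ≤ f n)
    (hf1 : HasSum f 1) : ∃ Q ∈ orthostochastic e, ∀ i, Q i 0 = f i := by
  classical
  have hmem : Memℓp (fun n => ((√(f n) : ℝ) : ℂ)) 2 := by
    refine memℓp_gen ?_
    simpa [Real.sq_sqrt (hf _)] using hf1.summable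
  set x : H := e.repr.symm ⟨_, hmem⟩ with hx
  have hxi : ∀ n, inner ℂ (e n) x = ((√(f n) : ℝ) : ℂ) := fun n => by
    rw [← e.repr_apply_apply, hx, LinearIsometryEquiv.apply_symm_apply]
  have hxn : ‖x‖ = 1 := by
    have h1 := hasSum_norm_inner_sq e x
    simp only [hxi, Complex.norm_real, Real.norm_eq_abs, sq_abs, Real.sq_sqrt (hf _)] at h1
    have h2 := h1.unique hf1
    exact (pow_eq_one_iff_of_nonneg (norm_nonneg x) two_ne_zero).mp h2
  set v : H := e 0 - x with hv
  have hvi : ∀ n, inner ℂ v (e n) = (((if 0 = n then 1 else 0) - √(f n) : ℝ) : ℂ) := fun n => by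
    rw [hv, inner_sub_left, inner_basis, ← inner_conj_symm x, hxi, Complex.conj_ofReal]
    split_ifs <;> simp
  have hvn : (inner ℂ v v : ℂ) = ((2 * (1 - √(f 0)) : ℝ) : ℂ) := by
    nth_rewrite 2 [hv]
    rw [inner_sub_right, hvi, hv, inner_sub_left, hxi, inner_self_eq_norm_sq_to_K, hxn]
    push_cast
    simp
    ring
  -- This is `2 / ‖v‖²`, the Householder coefficient; if `v = 0` then `x = e 0` and `U = 1`.
  set c : ℝ := if v = 0 then 0 else (1 - √(f 0))⁻¹ with hc
  have hv0 : v ≠ 0 → 1 - √(f 0) ≠ 0 := by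
    intro h h0
    rw [h0, mul_zero, Complex.ofReal_zero, inner_self_eq_zero] at hvn
    exact h hvn
  let U : H →L[ℂ] H := 1 - (c : ℂ) • (innerSL ℂ v).smulRight v
  have hU : ∀ y, U y = y - (c : ℂ) • inner ℂ v y • v := fun y => rfl
  have hUs : star U = U := by
    refine clm_ext_basis e fun j => eq_of_inner_basis e fun i => ?_
    rw [ContinuousLinearMap.star_eq_adjoint, ContinuousLinearMap.adjoint_inner_right, hU, hU,
      inner_sub_left, inner_sub_right, inner_smul_left, inner_smul_left, inner_smul_right,
      inner_smul_right, hvi, hvi, ← inner_conj_symm (e i) v, hvi]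
    simp only [Complex.conj_ofReal]
    ring
  have hUU : U * U = 1 := by
    refine ContinuousLinearMap.ext fun y => ?_
    rw [mul_apply_eq_comp, one_apply_eq_self, hU (U y), hU y, inner_sub_right, inner_smul_right,
      inner_smul_right, hvn]
    by_cases h : v = 0
    · simp [h]
    · have h1 : (c : ℂ) * ((2 * (1 - √(f 0)) : ℝ) : ℂ) = 2 := by
        rw [hc, if_neg h]
        have := hv0 h
        norm_cast
        field_simp
      have h2 : (c : ℂ) • (inner ℂ v y - (c : ℂ) * (inner ℂ v y * ((2 * (1 - √(f 0)) : ℝ) : ℂ))) • v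
          = -((c : ℂ) • inner ℂ v y • v) := by
        rw [smul_smul, smul_smul, ← neg_smul]
        congr 1
        linear_combination (-(c : ℂ) * inner ℂ v y) * h1
      rw [h2]
      abel
  have hU0 : U (e 0) = x := by
    rw [hU, hvi]
    by_cases h : v = 0
    · rw [h, smul_zero, smul_zero, sub_zero]
      exact sub_eq_zero.mp h
    · rw [smul_smul, hc, if_neg h, if_pos rfl]
      have := hv0 h
      rw [← Complex.ofReal_mul, inv_mul_cancel₀ this, Complex.ofReal_one, one_smul, hv,
        sub_sub_cancel]
  refine ⟨fun i j => ‖entry e U i j‖ ^ 2, ⟨U, Unitary.mem_iff.mpr ⟨by rw [hUs, hUU],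
    by rw [hUs, hUU]⟩, fun i j => ?_, fun i j => rfl⟩, fun i => ?_⟩
  · rw [entry, hU, inner_sub_right, inner_smul_right, inner_smul_right, hvi,
      ← inner_conj_symm (e i) v, hvi, inner_basis, Complex.conj_ofReal, ← Complex.ofReal_mul,
      ← Complex.ofReal_mul]
    split_ifs <;> simp
  · change ‖entry e U i 0‖ ^ 2 = f i
    rw [entry, hU0, hxi, Complex.norm_real, Real.norm_eq_abs, sq_abs, Real.sq_sqrt (hf i)]

theorem single_mem_c0Star : (Pi.single 0 1 : ℕ → ℝ) ∈ c0Star := by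
  refine ⟨fun n => ?_, antitone_nat_of_succ_le fun n => ?_, ?_⟩
  · by_cases h : n = 0 <;> simp [h]
  · rw [Pi.single_eq_of_ne (Nat.succ_ne_zero n)]
    by_cases h : n = 0 <;> simp [h]
  · refine tendsto_const_nhds.congr' ?_
    filter_upwards [eventually_gt_atTop 0] with n hn
    rw [Pi.single_eq_of_ne hn.ne']

theorem diagMem_single (e : HilbertBasis ℕ ℂ H) {I : TwoSidedIdeal (H →L[ℂ] H)} (hI : I ≠ ⊤)
    (hI0 : I ≠ ⊥) : DiagMem e I (Pi.single 0 1) := by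
  obtain ⟨X, hX, hX0⟩ : ∃ X ∈ I, X ≠ 0 := by
    by_contra! h
    refine hI0 (TwoSidedIdeal.ext fun X => ⟨fun hX => ?_, fun hX => ?_⟩)
    · rw [h X hX]
      exact TwoSidedIdeal.zero_mem _
    · rw [TwoSidedIdeal.mem_bot] at hX
      rw [hX]
      exact I.zero_mem
  have hXc : IsCompactOperator X := by
    by_contra h
    exact hI (eq_top_of_not_isCompactOperator e hX h)
  obtain ⟨ξ, hξ⟩ := IsCompactOperator.exists_isSNumbers e hXc
  have hpos : 0 < ξ 0 := by
    refine (hξ.2.1.1 0).lt_of_ne fun h0 => hX0 ?_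
    have h1 : ξ = 0 := by
      ext n
      exact le_antisymm ((hξ.2.1.2.1 (Nat.zero_le n)).trans h0.ge) (hξ.2.1.1 n)
    have h2 : X ∈ (⊥ : TwoSidedIdeal (H →L[ℂ] H)) := by
      rw [hξ.mem_iff (e := e), h1]
      exact ⟨0, TwoSidedIdeal.zero_mem _, fun n => by simp⟩
    exact (TwoSidedIdeal.mem_bot _).mp h2
  refine (hξ.mem_iff (e := e).mp hX).mono (M := (ξ 0)⁻¹) fun n => ?_
  by_cases h : n = 0
  · subst h
    rw [Pi.single_eq_same, abs_one, abs_of_pos hpos, inv_mul_cancel₀ hpos.ne']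
  · rw [Pi.single_eq_of_ne h, abs_zero]
    positivity

/-- An orthostochastic matrix with first column `ξ / ∑ ξ` maps the s-numbers of a rank-one
projection to that column. -/
theorem traceClass_subset (e : HilbertBasis ℕ ℂ H) {I : TwoSidedIdeal (H →L[ℂ] H)} (hI : I ≠ ⊤)
    (hI0 : I ≠ ⊥) (h : InvariantUnder I (orthostochastic e)) :
    traceClass H ⊆ (I : Set (H →L[ℂ] H)) := by
  rintro A ⟨ξ, hξ, hs⟩
  rw [SetLike.mem_coe, hξ.mem_iff (e := e)]
  have hξ0 := hξ.2.1.1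
  by_cases hz : ∑' n, ξ n = 0
  · have : ξ = 0 := by
      ext n
      exact (hs.hasSum_iff.mpr hz |> (hasSum_zero_iff_of_nonneg hξ0).mp) ▸ rfl
    rw [this]
    exact ⟨0, I.zero_mem, fun n => by simp⟩
  have hpos : 0 < ∑' n, ξ n := (tsum_nonneg hξ0).lt_of_ne (Ne.symm hz)
  set S := ∑' n, ξ n with hS
  have hsum : HasSum (fun n => ξ n / S) 1 := by
    have := hs.hasSum.div_const S
    rwa [← hS, div_self hz] at this
  obtain ⟨Q, hQ, hQ0⟩ := exists_orthostochastic_col e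
    (fun n => div_nonneg (hξ0 n) hpos.le) hsum
  have hact : act Q (Pi.single 0 1) = fun n => ξ n / S := by
    ext i
    rw [act, tsum_eq_single 0 fun j hj => by rw [Pi.single_eq_of_ne hj, mul_zero], hQ0,
      Pi.single_eq_same, mul_one]
  have h1 := h Q hQ _ ((mem_charSet_iff e).mpr ⟨single_mem_c0Star, diagMem_single e hI hI0⟩)
  have hlim : Tendsto (fun n => ξ n / S) atTop (𝓝 0) := hsum.summable.tendsto_atTop_zero
  rw [hact, rearrangement_mem_charSet_iff e (fun n => div_nonneg (hξ0 n) hpos.le) hlim] at h1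
  refine h1.mono (M := S) fun n => ?_
  rw [abs_div, abs_of_pos hpos, mul_div_cancel₀ _ hz]

/-! ### Block majorization -/

theorem exists_tail_min {D : ℕ → ℝ} (hD : Tendsto D atTop atTop) (N : ℕ) :
    ∃ p, N ≤ p ∧ ∀ m, p ≤ m → D p ≤ D m := by
  have hfin : {m | N ≤ m ∧ D m ≤ D N}.Finite := by
    have := hD.eventually (eventually_gt_atTop (D N))
    rw [← Nat.cofinite_eq_atTop, eventually_cofinite] at this
    exact this.subset fun m hm => not_lt.mpr hm.2
  obtain ⟨p, hp, hmin⟩ := Set.exists_min_image _ D hfin ⟨N, le_rfl, le_rfl⟩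
  refine ⟨p, hp.1, fun m hm => ?_⟩
  by_cases h : D m ≤ D N
  · exact hmin m ⟨hp.1.trans hm, h⟩
  · exact hp.2.trans (not_le.mp h).le

/-- At such indices the comparison of partial sums can restart from zero. -/
theorem exists_break_points {D : ℕ → ℝ} (hD : Tendsto D atTop atTop) (h0 : ∀ m, D 0 ≤ D m) :
    ∃ n : ℕ → ℕ, n 0 = 0 ∧ StrictMono n ∧ ∀ k m, D (n k) ≤ D (n k + m) := by
  choose g hg hg' using exists_tail_min hD
  let n : ℕ → ℕ := fun k => Nat.rec 0 (fun _ p => g (p + 1)) k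
  refine ⟨n, rfl, strictMono_nat_of_lt_succ fun k => ?_, fun k m => ?_⟩
  · exact hg (n k + 1)
  · cases k with
    | zero => exact h0 _
    | succ k => exact hg' (n k + 1) _ (Nat.le_add_right _ _)

/-- A sequence submajorized by `η` that is not summable is dominated, up to a factor `2`, by a
block orthostochastic image of `η`. -/
theorem exists_blockOrthostochastic_ge {ξ η : ℕ → ℝ} (hξ : ξ ∈ c0Star) (hη : η ∈ c0Star)
    (hns : ¬ Summable ξ) (hle : ∀ n, ∑ j ∈ Finset.range n, ξ j ≤ ∑ j ∈ Finset.range n, η j) :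
    ∃ Q ∈ blockOrthostochastic, ∀ i, ξ i / 2 ≤ act Q η i := by
  -- Halving `ξ` makes the gap at least half the partial sum of `ξ`, hence divergent.
  let D : ℕ → ℝ := fun m => ∑ j ∈ Finset.range m, η j - ∑ j ∈ Finset.range m, ξ j / 2
  have hhalf : ∀ m, ∑ j ∈ Finset.range m, ξ j / 2 = (∑ j ∈ Finset.range m, ξ j) / 2 := fun m =>
    (Finset.sum_div _ _ _).symm
  have hD : Tendsto D atTop atTop := by
    have h1 := (not_summable_iff_tendsto_nat_atTop_of_nonneg hξ.1).mp hns
    refine tendsto_atTop_mono (fun m => ?_) (h1.atTop_div_const (two_pos (α := ℝ)))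
    have := hle m
    simp only [D, hhalf]
    linarith
  have hD0 : ∀ m, D 0 ≤ D m := fun m => by
    have h1 := hle m
    have h2 : 0 ≤ ∑ j ∈ Finset.range m, ξ j := Finset.sum_nonneg fun j _ => hξ.1 j
    simp only [D, hhalf, Finset.range_zero, Finset.sum_empty]
    linarith
  obtain ⟨n, h0, hn, hmin⟩ := exists_break_points hD hD0
  choose l hl hlge using fun k => exists_orthogonal_ge
    (x := fun j => ξ (n k + j) / 2) (y := fun j => η (n k + j))
    (fun a b hab => div_le_div_of_nonneg_right (hξ.2.1 (by omega)) zero_le_two)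
    (fun a b hab => hη.2.1 (by omega)) (n (k + 1) - n k) (fun m _ => by
      have := hmin k m
      simp only [D, Finset.sum_range_add] at this
      linarith)
  choose k hk using exists_block h0 hn
  -- Assemble the orthogonal blocks; `k i` is the block containing `i`.
  let L : Matrix ℕ ℕ ℝ := fun i j => if k i = k j then l (k i) (i - n (k i)) (j - n (k i)) else 0
  have hz : ∀ i j, (¬ ∃ q, (n q ≤ i ∧ i < n (q + 1)) ∧ (n q ≤ j ∧ j < n (q + 1))) →
      L i j = 0 := by
    intro i j hij
    refine if_neg fun h => hij ⟨k i, hk i, ?_⟩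
    rw [h]
    exact hk j
  have hkq : ∀ q a, a < n (q + 1) - n q → k (n q + a) = q := fun q a ha =>
    block_unique hn (hk _) ⟨by omega, by omega⟩
  have hLq : ∀ q a b, a < n (q + 1) - n q → b < n (q + 1) - n q →
      L (n q + a) (n q + b) = l q a b := by
    intro q a b ha hb
    simp only [L, hkq q a ha, hkq q b hb, if_true, Nat.add_sub_cancel_left]
  refine ⟨fun i j => L i j ^ 2, ⟨L, ⟨n, h0, hn, hz, fun q => ?_⟩, fun i j => rfl⟩, fun i => ?_⟩
  · rw [SetLike.mem_coe, Matrix.mem_orthogonalGroup_iff]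
    ext a b
    have h1 := hl q a b a.2 b.2
    rw [Finset.sum_range] at h1
    simp only [Matrix.mul_apply, Matrix.transpose_apply, Matrix.of_apply, hLq q _ _ a.2 (Fin.is_lt _),
      hLq q _ _ b.2 (Fin.is_lt _), Matrix.one_apply]
    rw [h1]
    simp only [Fin.ext_iff]
  · have h1 := hasSum_block_row (M := fun i j => L i j ^ 2) hn
      (fun i j hij => by rw [hz i j hij]; simp) η (hk i)
    change _ ≤ ∑' j, L i j ^ 2 * η j
    rw [h1.tsum_eq]
    have hi := hk i
    have h2 := hlge (k i) (i - n (k i)) (by omega)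
    have hi' : n (k i) + (i - n (k i)) = i := by omega
    rw [hi'] at h2
    refine h2.trans (le_of_eq (Finset.sum_congr rfl fun b hb => ?_))
    have h3 := hLq (k i) (i - n (k i)) b (by omega) (Finset.mem_range.mp hb)
    rw [hi'] at h3
    rw [h3]

theorem isAmClosed_of_blockOrthostochastic (e : HilbertBasis ℕ ℂ H)
    {I : TwoSidedIdeal (H →L[ℂ] H)} (hI : I ≠ ⊤) (hL1 : traceClass H ⊆ (I : Set (H →L[ℂ] H)))
    (hinv : InvariantUnder I blockOrthostochastic) : IsAmClosed e I := by
  rw [isAmClosed_iff e hI]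
  intro ξ hξ η hη hle
  have hηc := ((mem_charSet_iff e).mp hη).1
  rw [mem_charSet_iff e, and_iff_right hξ]
  by_cases hs : Summable ξ
  · obtain ⟨D, -, hD⟩ := exists_isDiag e ξ (ξ 0) fun n => by
      rw [abs_of_nonneg (hξ.1 n)]
      exact hξ.2.1 (Nat.zero_le n)
    exact ⟨D, hL1 ⟨ξ, hD.isSNumbers hξ, hs⟩, hD⟩
  · have hsum : ∀ n, ∑ j ∈ Finset.range n, ξ j ≤ ∑ j ∈ Finset.range n, η j := by
      intro n
      cases n with
      | zero => simp
      | succ n =>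
        have := hle n
        rwa [arithMean, arithMean, div_le_div_iff_of_pos_right (by positivity)] at this
    obtain ⟨Q, hQ, hQξ⟩ := exists_blockOrthostochastic_ge hξ hηc hs hsum
    have hQs : Q ∈ substochastic :=
      (blockStochastic_subset (blockOrthostochastic_subset hQ)).1.1
    have h1 := hinv Q hQ η hη
    rw [rearrangement_mem_charSet_iff e (act_nonneg hQs.1 hηc.1) (tendsto_act hQs hηc)] at h1
    refine h1.mono (M := 2) fun n => ?_
    rw [abs_of_nonneg (hξ.1 n), abs_of_nonneg (act_nonneg hQs.1 hηc.1 n)]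
    have := hQξ n
    linarith

theorem IsAmClosed.invariantUnder {e : HilbertBasis ℕ ℂ H} {I : TwoSidedIdeal (H →L[ℂ] H)}
    (hI : I ≠ ⊤) (h : IsAmClosed e I) : InvariantUnder I substochastic := by
  rw [isAmClosed_iff e hI] at h
  intro P hP ξ hξ
  have hξc := ((mem_charSet_iff e).mp hξ).1
  exact h _ (rearrangement_mem_c0Star (tendsto_act hP hξc)) ξ hξ
    (arithMean_rearrangement_act_le hP hξc)

/-- Separate because the zero ideal does not contain the trace class. -/
theorem isAmClosed_bot (e : HilbertBasis ℕ ℂ H) (h : (⊥ : TwoSidedIdeal (H →L[ℂ] H)) ≠ ⊤) :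
    IsAmClosed e (⊥ : TwoSidedIdeal (H →L[ℂ] H)) := by
  rw [isAmClosed_iff e h]
  intro ξ hξ η hη hle
  obtain ⟨-, D, hD0, hD⟩ := (mem_charSet_iff e).mp hη
  rw [TwoSidedIdeal.mem_bot] at hD0
  have hη0 : ∀ n, η n = 0 := fun n => by
    have := hD n
    rw [hD0, zero_apply, eq_comm, smul_eq_zero] at this
    rcases this with h | h
    · exact_mod_cast h
    · exact absurd h (e.orthonormal.ne_zero n)
  have hξ0 : ξ = 0 := by
    have h1 := hle 0
    simp [arithMean, hη0] at h1
    ext n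
    exact le_antisymm ((hξ.2.1 (Nat.zero_le n)).trans h1) (hξ.1 n)
  rw [hξ0]
  exact (isCharSet_charSet e _).zero

theorem isAmClosed_of_orthostochastic (e : HilbertBasis ℕ ℂ H)
    {I : TwoSidedIdeal (H →L[ℂ] H)} (hI : I ≠ ⊤) (h : InvariantUnder I (orthostochastic e)) :
    IsAmClosed e I := by
  by_cases hI0 : I = ⊥
  · subst hI0
    exact isAmClosed_bot e hI
  · exact isAmClosed_of_blockOrthostochastic e hI (traceClass_subset e hI hI0 h)
      (h.mono (blockOrthostochastic_subset_orthostochastic e))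

end Operators

end AMIdeal

end

/-! ### The equivalences. -/

theorem corollary8p7 {H : Type*} [NormedAddCommGroup H] [InnerProductSpace ℂ H] [CompleteSpace H]
    (e : HilbertBasis ℕ ℂ H) (I : TwoSidedIdeal (H →L[ℂ] H)) (hI : I ≠ ⊤) :
    List.TFAE [
      AMIdeal.IsAmClosed e I,
      AMIdeal.InvariantUnder I AMIdeal.substochastic,
      AMIdeal.InvariantUnder I AMIdeal.rowStochastic,
      AMIdeal.InvariantUnder I AMIdeal.columnStochastic,
      AMIdeal.InvariantUnder I AMIdeal.doublyStochasticInf,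
      AMIdeal.InvariantUnder I (AMIdeal.isometryStochastic e),
      AMIdeal.InvariantUnder I (AMIdeal.coisometryStochastic e),
      AMIdeal.InvariantUnder I (AMIdeal.unistochastic e),
      AMIdeal.InvariantUnder I (AMIdeal.orthostochastic e)] ∧
    (I ≠ ⊥ → List.TFAE [
      AMIdeal.IsAmClosed e I,
      AMIdeal.traceClass H ⊆ (I : Set (H →L[ℂ] H)) ∧
        AMIdeal.InvariantUnder I AMIdeal.blockStochastic,
      AMIdeal.traceClass H ⊆ (I : Set (H →L[ℂ] H)) ∧
        AMIdeal.InvariantUnder I AMIdeal.blockOrthostochastic]) := by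
  have hsub : AMIdeal.doublyStochasticInf ⊆ AMIdeal.substochastic := fun P hP => hP.1.1
  have hortho : AMIdeal.orthostochastic e ⊆ AMIdeal.substochastic := fun P hP =>
    hsub (AMIdeal.unistochastic_subset_doublyStochasticInf e
      (AMIdeal.orthostochastic_subset_unistochastic e hP))
  constructor
  · tfae_have 1 → 2 := fun h => h.invariantUnder hI
    tfae_have 2 → 3 := fun h => h.mono fun P hP => hP.1
    tfae_have 2 → 4 := fun h => h.mono fun P hP => hP.1
    tfae_have 3 → 5 := fun h => h.mono fun P hP => hP.1
    tfae_have 4 → 5 := fun h => h.mono fun P hP => hP.2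
    tfae_have 2 → 6 := fun h => h.mono (AMIdeal.isometryStochastic_subset e)
    tfae_have 2 → 7 := fun h => h.mono (AMIdeal.coisometryStochastic_subset e)
    tfae_have 5 → 8 := fun h => h.mono (AMIdeal.unistochastic_subset_doublyStochasticInf e)
    tfae_have 6 → 8 := fun h => h.mono (AMIdeal.unistochastic_subset_isometryStochastic e)
    tfae_have 7 → 8 := fun h => h.mono (AMIdeal.unistochastic_subset_coisometryStochastic e)
    tfae_have 8 → 9 := fun h => h.mono (AMIdeal.orthostochastic_subset_unistochastic e)
    tfae_have 9 → 1 := AMIdeal.isAmClosed_of_orthostochastic e hI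
    tfae_finish
  · intro hI0
    tfae_have 1 → 2 := fun h => ⟨AMIdeal.traceClass_subset e hI hI0
      ((h.invariantUnder hI).mono hortho),
      (h.invariantUnder hI).mono (AMIdeal.blockStochastic_subset.trans hsub)⟩
    tfae_have 2 → 3 := fun h => ⟨h.1, h.2.mono AMIdeal.blockOrthostochastic_subset⟩
    tfae_have 3 → 1 := fun h => AMIdeal.isAmClosed_of_blockOrthostochastic e hI h.1 h.2
    tfae_finish
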